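/- Let $p$ be a prime, let $K$ be a global function field of characteristic $p$ (a finite extension of $\mathbf{F}_p(t)$), let $v$ be a place of $K$ with completion $K_v$, and write $\Omega^1_{K_v}$ for the absolute Kähler differentials of the field $K_v$. Let $X$ be a smooth $K$-scheme (for instance a smooth variety), let $\Omega^1_X$ be the sheaf of absolute Kähler differentials, and let $\omega\in H^0(X,\Omega^1_X)$. For $x\in X(K_v)$ let $\omega|_x\in\Omega^1_{K_v}$ be the pullback of $\omega$ along $x\colon \operatorname{Spec}K_v\to X$, and consider the evaluation map $$\mathrm{ev}_\omega\colon X(K_v)\to\Omega^1_{K_v},\qquad x\mapsto\omega|_x .$$ (1) $\Omega^1_{K_v}$ is a one-dimensional $K_v$-vector space, and for every $K_v$-linear isomorphism $\theta\colon\Omega^1_{K_v}\cong K_v$ the map $\theta\circ\mathrm{ev}_\omega\colon X(K_v)\to K_v$ is $p$-analytic. Here a function $g\colon X(K_v)\to K_v$ is called $p$-analytic if it is continuous for the $v$-adic topology, $K_v$ is finite over $K_v^p$, and, with $X_1$ the Weil restriction of $X_{K_v}$ from $K_v$ to $K_v^p=\{a^p : a\in K_v\}$, the function $g$ is analytic over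 the field $K_v^p$ (given locally by convergent power series) around every point when regarded as a function on $X_1(K_v^p)= X(K_v)$, with values in the $K_v^p$-vector space $K_v$. (2) Suppose moreover that $X$ is integral and that the image of $\omega$ in $H^0(X,\Omega^1_{X/K})$ is nonzero. Then $\mathrm{ev}_\omega$ is not constant around any point: for every $x\in X(K_v)$ and every $v$-adic neighbourhood $W$ of $x$ there is $y\in W$ with $\omega|_y\ne\omega|_x$. -/

import Mathlib

open CategoryTheory AlgebraicGeometry TensorProduct Topology
open scoped KaehlerDifferential

universe u

noncomputable section

/-! ### Weil restriction of affine schemes along a finite field extension -/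

namespace WeilRes

variable {k L : Type u} [Field k] [Field L] [Algebra k L] {n : ℕ} (b : Module.Basis (Fin n) k L)
  (B : Type u) [CommRing B] [Algebra L B]

/-- The equations, in the variables `X (x, i)` for `x : B` and `i : Fin n`, which say that
`x ↦ ∑ i, b i ⊗ X (x, i)` is a homomorphism of `L`-algebras. -/
inductive Rel : MvPolynomial (B × Fin n) k → Prop
  | add (x y : B) (i : Fin n) :
      Rel (MvPolynomial.X (x + y, i) - (MvPolynomial.X (x, i) + MvPolynomial.X (y, i)))
  | mul (x y : B) (i : Fin n) :
      Rel (MvPolynomial.X (x * y, i) -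
        ∑ j, ∑ l, MvPolynomial.C (b.repr (b j * b l) i) *
          (MvPolynomial.X (x, j) * MvPolynomial.X (y, l)))
  | scalar (c : L) (i : Fin n) :
      Rel (MvPolynomial.X (algebraMap L B c, i) - MvPolynomial.C (b.repr c i))

/-- The coordinate ring of the Weil restriction of `Spec B` from `L` to `k`, where `L/k` is a
finite extension with basis `b`. It represents `S ↦ Hom_L(B, L ⊗[k] S)` on `k`-algebras, see
`WeilRes.bijective`. -/
def Ring : Type u := MvPolynomial (B × Fin n) k ⧸ Ideal.span {q | Rel b B q}

instance : CommRing (Ring b B) :=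
  inferInstanceAs (CommRing (MvPolynomial (B × Fin n) k ⧸ Ideal.span {q | Rel b B q}))

instance : Algebra k (Ring b B) :=
  inferInstanceAs (Algebra k (MvPolynomial (B × Fin n) k ⧸ Ideal.span {q | Rel b B q}))

/-- The quotient map from the polynomial ring. -/
def mk : MvPolynomial (B × Fin n) k →ₐ[k] Ring b B :=
  Ideal.Quotient.mkₐ k (Ideal.span {q | Rel b B q})

variable {B} in
/-- The coordinate function `X (x, i)` on the Weil restriction. -/
def coord (x : B) (i : Fin n) : Ring b B := mk b B (MvPolynomial.X (x, i))

lemma mk_rel {q : MvPolynomial (B × Fin n) k} (h : Rel b B q) : mk b B q = 0 :=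
  Ideal.Quotient.eq_zero_iff_mem.mpr (Ideal.subset_span h)

lemma coord_add (x y : B) (i : Fin n) :
    coord b (x + y) i = coord b x i + coord b y i := by
  have := mk_rel b B (Rel.add x y i)
  rw [map_sub, sub_eq_zero, map_add] at this
  exact this

lemma coord_mul (x y : B) (i : Fin n) :
    coord b (x * y) i =
      ∑ j, ∑ l, b.repr (b j * b l) i • (coord b x j * coord b y l) := by
  have := mk_rel b B (Rel.mul x y i)
  rw [map_sub, sub_eq_zero] at this
  simp only [map_sum, map_mul, ← MvPolynomial.algebraMap_eq, AlgHom.commutes] at this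
  simpa only [coord, Algebra.smul_def] using this

lemma coord_scalar (c : L) (i : Fin n) :
    coord b (algebraMap L B c) i = algebraMap k (Ring b B) (b.repr c i) := by
  have := mk_rel b B (Rel.scalar (B := B) c i)
  rw [map_sub, sub_eq_zero, ← MvPolynomial.algebraMap_eq, AlgHom.commutes] at this
  exact this

lemma sum_scalar (S : Type u) [CommRing S] [Algebra k S] (c : L) :
    ∑ i, b i ⊗ₜ[k] algebraMap k S (b.repr c i) = c ⊗ₜ[k] (1 : S) := by
  simp only [Algebra.algebraMap_eq_smul_one, ← TensorProduct.smul_tmul, ← TensorProduct.sum_tmul]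
  rw [b.sum_repr]

/-- The universal homomorphism. -/
def univ : B →ₐ[L] L ⊗[k] Ring b B where
  toFun x := ∑ i, b i ⊗ₜ[k] coord b x i
  map_one' := by
    have h := sum_scalar b (Ring b B) 1
    rw [← map_one (algebraMap L B)]
    simp only [coord_scalar]
    exact h
  map_zero' := by
    have h := sum_scalar b (Ring b B) 0
    rw [← map_zero (algebraMap L B)]
    simpa only [coord_scalar, TensorProduct.zero_tmul] using h
  map_add' x y := by
    simp only [coord_add, TensorProduct.tmul_add, Finset.sum_add_distrib]
  map_mul' x y := by
    simp only [coord_mul, TensorProduct.tmul_sum, Finset.sum_mul, Finset.mul_sum,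
      Algebra.TensorProduct.tmul_mul_tmul, ← TensorProduct.smul_tmul]
    rw [Finset.sum_comm]
    conv_rhs => rw [Finset.sum_comm]
    refine Finset.sum_congr rfl fun j _ => ?_
    rw [Finset.sum_comm]
    refine Finset.sum_congr rfl fun l _ => ?_
    rw [← TensorProduct.sum_tmul, b.sum_repr]
  commutes' c := by
    simp only [coord_scalar]
    exact sum_scalar b (Ring b B) c

lemma univ_apply (x : B) : univ b B x = ∑ i, b i ⊗ₜ[k] coord b x i := rfl

/-- The map `Hom_k(Ring b B, S) → Hom_L(B, L ⊗[k] S)` induced by the universal homomorphism. -/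
def toHom {S : Type u} [CommRing S] [Algebra k S] (ψ : Ring b B →ₐ[k] S) : B →ₐ[L] L ⊗[k] S :=
  (Algebra.TensorProduct.map (AlgHom.id L L) ψ).comp (univ b B)

lemma toHom_apply {S : Type u} [CommRing S] [Algebra k S] (ψ : Ring b B →ₐ[k] S) (x : B) :
    toHom b B ψ x = ∑ i, b i ⊗ₜ[k] ψ (coord b x i) := by
  simp [toHom, univ_apply]

/-- The coordinates of an element of `L ⊗[k] S` with respect to the basis `b`. -/
def coeff (S : Type u) [CommRing S] [Algebra k S] (i : Fin n) : L ⊗[k] S →ₗ[k] S :=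
  (TensorProduct.lid k S).toLinearMap ∘ₗ (b.coord i).rTensor S

lemma coeff_tmul {S : Type u} [CommRing S] [Algebra k S] (i : Fin n) (c : L) (s : S) :
    coeff b S i (c ⊗ₜ s) = b.repr c i • s := by
  simp [coeff]

lemma coeff_sum {S : Type u} [CommRing S] [Algebra k S] (i : Fin n) (s : Fin n → S) :
    coeff b S i (∑ j, b j ⊗ₜ s j) = s i := by
  simp [coeff_tmul, Finsupp.single_apply]

lemma sum_coeff {S : Type u} [CommRing S] [Algebra k S] (z : L ⊗[k] S) :
    ∑ i, b i ⊗ₜ[k] coeff b S i z = z := by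
  induction z with
  | zero => simp
  | add x y hx hy =>
    simp only [map_add, TensorProduct.tmul_add, Finset.sum_add_distrib, hx, hy]
  | tmul c s =>
    simp only [coeff_tmul, ← TensorProduct.smul_tmul, ← TensorProduct.sum_tmul]
    rw [b.sum_repr]

/-- The defining property of the Weil restriction. -/
theorem bijective (S : Type u) [CommRing S] [Algebra k S] :
    Function.Bijective (toHom b B : (Ring b B →ₐ[k] S) → (B →ₐ[L] L ⊗[k] S)) := by
  constructor
  · intro ψ χ h
    have key : ∀ x i, ψ (coord b x i) = χ (coord b x i) := fun x i => by
      have := congrArg (coeff b S i) (DFunLike.congr_fun h x)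
      simpa only [toHom_apply, coeff_sum] using this
    have h2 : ψ.comp (mk b B) = χ.comp (mk b B) :=
      MvPolynomial.algHom_ext fun p => key p.1 p.2
    refine AlgHom.ext fun r => ?_
    obtain ⟨q, rfl⟩ := Ideal.Quotient.mk_surjective r
    exact DFunLike.congr_fun h2 q
  · intro φ
    let e : MvPolynomial (B × Fin n) k →ₐ[k] S :=
      MvPolynomial.aeval fun p => coeff b S p.2 (φ p.1)
    have he : ∀ q ∈ Ideal.span {q | Rel b B q}, e q = 0 := by
      intro q hq
      have hle : Ideal.span {q | Rel b B q} ≤ RingHom.ker e := by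
        rw [Ideal.span_le]
        rintro q (⟨x, y, i⟩ | ⟨x, y, i⟩ | ⟨c, i⟩)
        · simp [RingHom.mem_ker, e]
        · have h1 : φ (x * y) = ∑ i, b i ⊗ₜ[k]
              (∑ j, ∑ l, b.repr (b j * b l) i • (coeff b S j (φ x) * coeff b S l (φ y))) := by
            rw [map_mul]
            conv_lhs => rw [← sum_coeff b (φ x), ← sum_coeff b (φ y)]
            simp only [TensorProduct.tmul_sum, Finset.sum_mul, Finset.mul_sum,
              Algebra.TensorProduct.tmul_mul_tmul, ← TensorProduct.smul_tmul]
            symm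
            rw [Finset.sum_comm]
            conv_rhs => rw [Finset.sum_comm]
            refine Finset.sum_congr rfl fun j _ => ?_
            rw [Finset.sum_comm]
            refine Finset.sum_congr rfl fun l _ => ?_
            rw [← TensorProduct.sum_tmul, b.sum_repr]
          have h2 := congrArg (coeff b S i) h1
          rw [coeff_sum] at h2
          simp only [SetLike.mem_coe, RingHom.mem_ker, map_sub, map_sum, map_mul, sub_eq_zero, e,
            MvPolynomial.aeval_X, MvPolynomial.aeval_C, ← Algebra.smul_def]
          simpa only [map_mul] using h2
        · have h1 : coeff b S i (φ (algebraMap L B c)) = b.repr c i • (1 : S) := by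
            rw [φ.commutes]
            exact coeff_tmul b i c 1
          simp only [SetLike.mem_coe, RingHom.mem_ker, map_sub, sub_eq_zero, e,
            MvPolynomial.aeval_X, MvPolynomial.aeval_C]
          rw [h1, Algebra.algebraMap_eq_smul_one]
      exact hle hq
    let ψ : Ring b B →ₐ[k] S := Ideal.Quotient.liftₐ _ e he
    have hψ : ∀ x i, ψ (coord b x i) = coeff b S i (φ x) := fun x i =>
      MvPolynomial.aeval_X _ _
    refine ⟨ψ, AlgHom.ext fun x => ?_⟩
    rw [toHom_apply]
    conv_rhs => rw [← sum_coeff b (φ x)]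
    simp only [hψ]

/-- The `L`-point of `Spec B` that corresponds to a `k`-point of the Weil restriction. -/
def toPoint (ψ : Ring b B →ₐ[k] k) : B →ₐ[L] L :=
  (Algebra.TensorProduct.rid k L L).toAlgHom.comp (toHom b B ψ)

end WeilRes

/-! ### Analytic functions on the rational points of an affine scheme -/

/-- Let `A` be an algebra of finite type over a complete valued field `k`. A function `g` on the
`k`-points of `Spec A` is analytic at `ψ` if, for a closed embedding of `Spec A` into an affine
space over `k`, it agrees near `ψ` with the restriction of a function on the affine space that is
given by a convergent power series around the image of `ψ`. -/
def AnalyticAtPoint {k A E : Type*} [NontriviallyNormedField k] [CommRing A] [Algebra k A]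
    [NormedAddCommGroup E] [NormedSpace k E] (g : (A →ₐ[k] k) → E) (ψ : A →ₐ[k] k) : Prop :=
  ∃ (N : ℕ) (a : Fin N → A), Algebra.adjoin k (Set.range a) = ⊤ ∧
    ∃ F : (Fin N → k) → E, AnalyticAt k F (fun j => ψ (a j)) ∧
      ∀ᶠ y in 𝓝 (fun j => ψ (a j)), ∀ χ : A →ₐ[k] k, (fun j => χ (a j)) = y → g χ = F y

/-! ### Points of a scheme with values in a field -/

section Points

variable {K : Type u} [Field K] {X : Scheme.{u}} (f : X ⟶ Spec (.of K))

/-- The ring `Γ(X, U)`, as a `K`-algebra through the structure morphism `f`. -/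
def Sec (_ : X ⟶ Spec (.of K)) (U : X.Opens) : Type u := Γ(X, U)

instance (U : X.Opens) : CommRing (Sec f U) := inferInstanceAs (CommRing Γ(X, U))

/-- The structure map of `Γ(X, U)` as a `K`-algebra. -/
def secMap (U : X.Opens) : CommRingCat.of K ⟶ Γ(X, U) :=
  (Scheme.ΓSpecIso (.of K)).inv ≫ f.appLE ⊤ U le_top

instance (U : X.Opens) : Algebra K (Sec f U) := (secMap f U).hom.toAlgebra

lemma algebraMap_sec (U : X.Opens) : algebraMap K (Sec f U) = (secMap f U).hom := rfl

variable (L : Type u) [Field L] [Algebra K L]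

/-- The set `X(L)` of `L`-points of the `K`-scheme `X`. -/
def Point : Type u :=
  {x : Spec (.of L) ⟶ X // x ≫ f = Spec.map (CommRingCat.ofHom (algebraMap K L))}

variable {f L} {U : X.Opens}

lemma fromSpec_comp (hU : IsAffineOpen U) : hU.fromSpec ≫ f = Spec.map (secMap f U) := by
  rw [← IsAffineOpen.SpecMap_appLE_fromSpec f (isAffineOpen_top (Spec (.of K))) hU le_top,
    IsAffineOpen.fromSpec_top, Scheme.isoSpec_Spec_inv, ← Spec.map_comp]
  rfl

/-- The point of `X` in the affine open `U` that corresponds to a `K`-homomorphism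
`Γ(X, U) → L`. -/
def Point.ofHom (hU : IsAffineOpen U) (φ : Sec f U →ₐ[K] L) : Point f L :=
  ⟨Spec.map (CommRingCat.ofHom (R := Γ(X, U)) (S := L) φ.toRingHom) ≫ hU.fromSpec, by
    rw [Category.assoc, fromSpec_comp, ← Spec.map_comp]
    congr 1
    ext c
    exact φ.commutes c⟩

/-- The topology on `U(L)`, for `U` affine and `L` a topological field: the coarsest one for which
all regular functions on `U` are continuous. -/
abbrev affineTopology (f : X ⟶ Spec (.of K)) (L : Type u) [Field L] [Algebra K L]
    [TopologicalSpace L] (U : X.Opens) : TopologicalSpace (Sec f U →ₐ[K] L) :=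
  TopologicalSpace.induced (fun φ s => φ s) (inferInstance : TopologicalSpace (Sec f U → L))

/-- The topology on `X(L)`: a set is open if its intersection with `U(L)` is open for each affine
open `U` of `X`. -/
instance [TopologicalSpace L] : TopologicalSpace (Point f L) :=
  ⨆ U : X.affineOpens, TopologicalSpace.coinduced (Point.ofHom U.2) (affineTopology f L U)

/-- Restriction of functions to a smaller open set. -/
def Sec.res (f : X ⟶ Spec (.of K)) {U V : X.Opens} (h : V ≤ U) : Sec f U →ₐ[K] Sec f V where
  __ := (X.presheaf.map (homOfLE h).op).hom
  commutes' c := by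
    have : secMap f U ≫ X.presheaf.map (homOfLE h).op = secMap f V := by
      exact (Category.assoc _ _ _).trans
        (congrArg ((Scheme.ΓSpecIso (.of K)).inv ≫ ·) (f.appLE_map le_top (homOfLE h).op))
    exact congrArg (fun g : CommRingCat.of K ⟶ Γ(X, V) => g.hom c) this

/-- Every point lies in an affine open, which may be chosen inside a given neighbourhood. -/
lemma Point.exists_ofHom_le (x : Point f L) (W : X.Opens)
    (hW : ∀ z, x.1 z ∈ W) :
    ∃ (U : X.Opens) (hU : IsAffineOpen U) (φ : Sec f U →ₐ[K] L), U ≤ W ∧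
      Point.ofHom hU φ = x := by
  let z₀ : Spec (.of L) := IsLocalRing.closedPoint L
  obtain ⟨U, hU, hz, hUW⟩ := exists_isAffineOpen_mem_and_subset (hW z₀)
  have hr : Set.range x.1 ⊆ Set.range hU.fromSpec := by
    rw [hU.range_fromSpec]
    rintro _ ⟨z, rfl⟩
    obtain rfl : z = z₀ := Subsingleton.elim (α := PrimeSpectrum L) _ _
    exact hz
  let y : Spec (.of L) ⟶ Spec Γ(X, U) := IsOpenImmersion.lift hU.fromSpec x.1 hr
  have hy : y ≫ hU.fromSpec = x.1 := IsOpenImmersion.lift_fac _ _ _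
  have hK : secMap f U ≫ Spec.preimage y = CommRingCat.ofHom (algebraMap K L) := by
    apply Spec.map_injective
    rw [Spec.map_comp, Spec.map_preimage, ← x.2, ← hy, Category.assoc, fromSpec_comp hU]
  let φ : Sec f U →ₐ[K] L :=
    { (Spec.preimage y).hom with
      commutes' := fun c => congrArg (fun g : CommRingCat.of K ⟶ CommRingCat.of L => g.hom c) hK }
  refine ⟨U, hU, φ, hUW, Subtype.ext ?_⟩
  change Spec.map (Spec.preimage y) ≫ hU.fromSpec = x.1
  rw [Spec.map_preimage, hy]

lemma Point.exists_ofHom (x : Point f L) :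
    ∃ (U : X.affineOpens) (φ : Sec f U.1 →ₐ[K] L), Point.ofHom U.2 φ = x := by
  obtain ⟨U, hU, φ, -, h⟩ := x.exists_ofHom_le ⊤ (fun _ => trivial)
  exact ⟨⟨U, hU⟩, φ, h⟩

lemma Point.ofHom_injective (hU : IsAffineOpen U) :
    Function.Injective (Point.ofHom hU : (Sec f U →ₐ[K] L) → Point f L) := by
  intro φ ψ h
  have h1 := congrArg Subtype.val h
  have h2 := Spec.map_injective ((cancel_mono hU.fromSpec).mp h1)
  refine AlgHom.ext fun s => ?_
  exact congrArg (fun g : Γ(X, U) ⟶ CommRingCat.of L => g.hom s) h2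

lemma Point.ofHom_res {V : X.Opens} (hU : IsAffineOpen U) (hV : IsAffineOpen V) (h : V ≤ U)
    (φ : Sec f V →ₐ[K] L) : Point.ofHom hU (φ.comp (Sec.res f h)) = Point.ofHom hV φ := by
  apply Subtype.ext
  change Spec.map (X.presheaf.map (homOfLE h).op ≫ CommRingCat.ofHom φ.toRingHom) ≫ _ =
    Spec.map (CommRingCat.ofHom φ.toRingHom) ≫ _
  rw [Spec.map_comp, Category.assoc, IsAffineOpen.map_fromSpec hU hV]
  rfl

end Points

/-! ### Global 1-forms and their pullbacks -/

section Forms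

/-- The pullback of absolute 1-forms along a ring homomorphism. -/
def pullForm {A B : Type u} [CommRing A] [CommRing B] (φ : A →+* B) : Ω[A⁄ℤ] →+ Ω[B⁄ℤ] :=
  letI := φ.toAlgebra
  (KaehlerDifferential.map ℤ ℤ A B).toAddMonoidHom

/-- The pullback of 1-forms relative to `K` along a homomorphism of `K`-algebras. -/
def pullRelForm {K A B : Type u} [Field K] [CommRing A] [CommRing B] [Algebra K A] [Algebra K B]
    (φ : A →ₐ[K] B) : Ω[A⁄K] →+ Ω[B⁄K] :=
  letI := φ.toRingHom.toAlgebra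
  haveI : IsScalarTower K A B := IsScalarTower.of_algebraMap_eq fun c => (φ.commutes c).symm
  (KaehlerDifferential.map K K A B).toAddMonoidHom

lemma pullForm_D {A B : Type u} [CommRing A] [CommRing B] (φ : A →+* B) (a : A) :
    pullForm φ (KaehlerDifferential.D ℤ A a) = KaehlerDifferential.D ℤ B (φ a) :=
  let := φ.toAlgebra
  KaehlerDifferential.map_D ℤ ℤ A B a

lemma pullForm_smul {A B : Type u} [CommRing A] [CommRing B] (φ : A →+* B) (a : A) (η : Ω[A⁄ℤ]) :
    pullForm φ (a • η) = φ a • pullForm φ η := by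
  let := φ.toAlgebra
  exact (map_smul (KaehlerDifferential.map ℤ ℤ A B) a η).trans (algebraMap_smul B a _).symm

lemma pullForm_comp {A B C : Type u} [CommRing A] [CommRing B] [CommRing C] (φ : A →+* B)
    (ψ : B →+* C) (η : Ω[A⁄ℤ]) : pullForm ψ (pullForm φ η) = pullForm (ψ.comp φ) η := by
  have hη : η ∈ Submodule.span A (Set.range (KaehlerDifferential.D ℤ A)) := by
    rw [KaehlerDifferential.span_range_derivation]
    trivial
  induction hη using Submodule.span_induction with
  | mem x hx =>
    obtain ⟨a, rfl⟩ := hx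
    simp only [pullForm_D, RingHom.comp_apply]
  | zero => simp
  | add x y _ _ hx hy => simp only [map_add, hx, hy]
  | smul a x _ hx => simp only [pullForm_smul, hx, RingHom.comp_apply]

variable {K : Type u} [Field K] {X : Scheme.{u}} (f : X ⟶ Spec (.of K))

/-- `H⁰(X, Ω¹_X)`: the compatible families of absolute 1-forms on the affine open subsets of `X`.
(The structure morphism `f` only serves to write `Γ(X, U)` as `Sec f U`.) -/
def GlobalForms : AddSubgroup (∀ U : X.affineOpens, Ω[Sec f U.1⁄ℤ]) where
  carrier := {ω | ∀ (U V : X.affineOpens) (h : V.1 ≤ U.1),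
    pullForm (Sec.res f h).toRingHom (ω U) = ω V}
  zero_mem' U V h := map_zero _
  add_mem' hx hy U V h := by
    rw [Pi.add_apply, Pi.add_apply, map_add, hx U V h, hy U V h]
  neg_mem' hx U V h := by
    rw [Pi.neg_apply, Pi.neg_apply, map_neg, hx U V h]

/-- `H⁰(X, Ω¹_{X/K})`: the compatible families of 1-forms relative to `K` on the affine open
subsets of `X`. -/
def GlobalRelForms : AddSubgroup (∀ U : X.affineOpens, Ω[Sec f U.1⁄K]) where
  carrier := {ω | ∀ (U V : X.affineOpens) (h : V.1 ≤ U.1), pullRelForm (Sec.res f h) (ω U) = ω V}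
  zero_mem' U V h := map_zero _
  add_mem' hx hy U V h := by
    rw [Pi.add_apply, Pi.add_apply, map_add, hx U V h, hy U V h]
  neg_mem' hx U V h := by
    rw [Pi.neg_apply, Pi.neg_apply, map_neg, hx U V h]

/-- The canonical map `Ω¹_A → Ω¹_{A/K}`. -/
def relForm (K A : Type u) [Field K] [CommRing A] [Algebra K A] : Ω[A⁄ℤ] →+ Ω[A⁄K] :=
  (KaehlerDifferential.map ℤ K A A).toAddMonoidHom

lemma relForm_pullForm {A B : Type u} [CommRing A] [CommRing B] [Algebra K A] [Algebra K B]
    (φ : A →ₐ[K] B) (η : Ω[A⁄ℤ]) :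
    relForm K B (pullForm φ.toRingHom η) = pullRelForm φ (relForm K A η) := by
  have hη : η ∈ Submodule.span A (Set.range (KaehlerDifferential.D ℤ A)) := by
    rw [KaehlerDifferential.span_range_derivation]
    trivial
  let := φ.toRingHom.toAlgebra
  have : IsScalarTower K A B := IsScalarTower.of_algebraMap_eq fun c => (φ.commutes c).symm
  have h1 : ∀ (a : A) (x : Ω[A⁄K]), pullRelForm φ (a • x) = φ a • pullRelForm φ x := fun a x =>
    (map_smul (KaehlerDifferential.map K K A B) a x).trans (algebraMap_smul B a _).symm
  have h2 : ∀ a : A, pullRelForm φ (KaehlerDifferential.D K A a) = KaehlerDifferential.D K B (φ a) :=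
    fun a => KaehlerDifferential.map_D K K A B a
  have h3 : ∀ (a : A) (x : Ω[A⁄ℤ]), relForm K A (a • x) = a • relForm K A x := fun a x =>
    map_smul (KaehlerDifferential.map ℤ K A A) a x
  have h4 : ∀ (a : B) (x : Ω[B⁄ℤ]), relForm K B (a • x) = a • relForm K B x := fun a x =>
    map_smul (KaehlerDifferential.map ℤ K B B) a x
  have h5 : ∀ a : A, relForm K A (KaehlerDifferential.D ℤ A a) = KaehlerDifferential.D K A a :=
    fun a => KaehlerDifferential.map_D ℤ K A A a
  have h6 : ∀ a : B, relForm K B (KaehlerDifferential.D ℤ B a) = KaehlerDifferential.D K B a :=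
    fun a => KaehlerDifferential.map_D ℤ K B B a
  induction hη using Submodule.span_induction with
  | mem x hx =>
    obtain ⟨a, rfl⟩ := hx
    rw [pullForm_D, h5, h6, h2]
    rfl
  | zero => simp
  | add x y _ _ hx hy => simp only [map_add, hx, hy]
  | smul a x _ hx =>
    rw [pullForm_smul, h4, hx, h3, h1]
    rfl

/-- The canonical map `H⁰(X, Ω¹_X) → H⁰(X, Ω¹_{X/K})`. -/
def GlobalForms.toRel : GlobalForms f →+ GlobalRelForms f where
  toFun ω := ⟨fun U => relForm K (Sec f U.1) (ω.1 U), fun U V h => by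
    rw [← relForm_pullForm, ω.2 U V h]⟩
  map_zero' := Subtype.ext (funext fun _ => map_zero _)
  map_add' _ _ := Subtype.ext (funext fun _ => map_add _ _ _)

variable {f} {L : Type u} [Field L] [Algebra K L]

/-- The pullback `ω|_x ∈ Ω¹_L` of a global 1-form `ω` along an `L`-point `x`, computed on an affine
open through which `x` factors; see `GlobalForms.eval_ofHom`. -/
def GlobalForms.eval (ω : GlobalForms f) (x : Point f L) : Ω[L⁄ℤ] :=
  pullForm x.exists_ofHom.choose_spec.choose.toRingHom (ω.1 x.exists_ofHom.choose)

/-- The value `ω|_x` does not depend on the affine open used to compute it. -/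
theorem GlobalForms.eval_ofHom (ω : GlobalForms f) (U : X.affineOpens) (φ : Sec f U.1 →ₐ[K] L) :
    GlobalForms.eval ω (Point.ofHom U.2 φ) = pullForm φ.toRingHom (ω.1 U) := by
  set x := Point.ofHom U.2 φ with hx
  set U' := x.exists_ofHom.choose with hU'
  set φ' := x.exists_ofHom.choose_spec.choose with hφ'
  have hx' : Point.ofHom U'.2 φ' = x := x.exists_ofHom.choose_spec.choose_spec
  have mem : ∀ (V : X.affineOpens) (θ : Sec f V.1 →ₐ[K] L) (z : Spec (.of L)),
      (Point.ofHom V.2 θ).1 z ∈ V.1 := fun V θ z => by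
    have h : (V.2.fromSpec (Spec.map (CommRingCat.ofHom (R := Γ(X, V.1)) (S := L)
        θ.toRingHom) z)) ∈ (V.1 : Set X) := by
      rw [← V.2.range_fromSpec]
      exact ⟨_, rfl⟩
    exact h
  obtain ⟨W, hW, θ, hle, hθ⟩ := x.exists_ofHom_le (U.1 ⊓ U'.1) fun z =>
    ⟨mem U φ z, by rw [← hx']; exact mem U' φ' z⟩
  have e1 : θ.comp (Sec.res f (hle.trans inf_le_left)) = φ :=
    Point.ofHom_injective U.2 (by rw [Point.ofHom_res U.2 hW, hθ])
  have e2 : θ.comp (Sec.res f (hle.trans inf_le_right)) = φ' :=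
    Point.ofHom_injective U'.2 (by rw [Point.ofHom_res U'.2 hW, hθ, hx'])
  have key : ∀ (V : X.affineOpens) (h : W ≤ V.1),
      pullForm (θ.comp (Sec.res f h)).toRingHom (ω.1 V) = pullForm θ.toRingHom (ω.1 ⟨W, hW⟩) :=
    fun V h => by
      rw [← ω.2 V ⟨W, hW⟩ h, pullForm_comp]
      rfl
  change pullForm φ'.toRingHom (ω.1 U') = _
  rw [← e1, ← e2, key, key]

end Forms

/-! ### Functions that are analytic after Weil restriction -/

/-- A function `g` on `X(L)` is analytic after Weil restriction from `L` to `k` if `L/k` is finite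
and, for each affine open `U` of `X`, the function on the `k`-points of the Weil restriction of
`U_L = Spec (L ⊗[K] Γ(X, U))` that corresponds to `g` is analytic at every point. -/
def AnalyticAfterWeilRestriction {K k L : Type u} [Field K] [NontriviallyNormedField k] [Field L]
    [Algebra k L] [Algebra K L] {X : Scheme.{u}} {f : X ⟶ Spec (.of K)} {E : Type*}
    [NormedAddCommGroup E] [NormedSpace k E] (g : Point f L → E) : Prop :=
  ∃ (n : ℕ) (b : Module.Basis (Fin n) k L), ∀ (U : X.affineOpens)
    (ψ : WeilRes.Ring b (L ⊗[K] Sec f U.1) →ₐ[k] k),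
    AnalyticAtPoint (fun χ : WeilRes.Ring b (L ⊗[K] Sec f U.1) →ₐ[k] k =>
      g (Point.ofHom U.2
        (((WeilRes.toPoint b (L ⊗[K] Sec f U.1) χ).restrictScalars K).comp
          Algebra.TensorProduct.includeRight))) ψ

/-! ### Completions -/

/-- A place of `K`, given by a nontrivial absolute value that represents it. -/
structure Place (K : Type u) [Field K] where
  /-- The absolute value. -/
  abv : AbsoluteValue K ℝ
  nontrivial : abv.IsNontrivial

namespace Place

variable {K : Type u} [Field K] (v : Place K)

/-- The completion `K_v`. -/
def Completion : Type u := v.abv.Completion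

instance : NormedField v.Completion := inferInstanceAs (NormedField v.abv.Completion)

instance : Algebra K v.Completion := inferInstanceAs (Algebra K v.abv.Completion)

instance : NontriviallyNormedField v.Completion where
  non_trivial := by
    obtain ⟨x, hx⟩ := v.nontrivial.exists_abv_gt_one
    refine ⟨((WithAbs.toAbs v.abv x : WithAbs v.abv) : v.abv.Completion), ?_⟩
    exact hx.trans_eq (UniformSpace.Completion.norm_coe (WithAbs.toAbs v.abv x)).symm

instance (p : ℕ) [CharP K p] : CharP v.Completion p :=
  charP_of_injective_algebraMap (algebraMap K v.Completion).injective p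

end Place

/-- The subfield `L^p` of `p`-th powers of a field `L` of characteristic `p`. -/
abbrev PowSubfield (p : ℕ) [Fact p.Prime] (L : Type u) [Field L] [CharP L p] : Subfield L :=
  (frobenius L p).fieldRange

instance (p : ℕ) [Fact p.Prime] (L : Type u) [NontriviallyNormedField L] [CharP L p] :
    NontriviallyNormedField (PowSubfield p L) where
  non_trivial := by
    obtain ⟨x, hx⟩ := NontriviallyNormedField.non_trivial (α := L)
    refine ⟨⟨x ^ p, x, rfl⟩, ?_⟩
    change 1 < ‖x ^ p‖
    rw [norm_pow]
    exact one_lt_pow₀ hx (Nat.Prime.ne_zero Fact.out)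

instance (p : ℕ) [Fact p.Prime] (L : Type u) [NontriviallyNormedField L] [CharP L p] :
    NormedSpace (PowSubfield p L) L where
  norm_smul_le a x := (norm_mul a.1 x).le

/-- A function on `X(L)` is `p`-analytic if it is continuous, and analytic after Weil restriction
to `L^p`. -/
def IsPAnalytic (p : ℕ) [Fact p.Prime] {K L : Type u} [Field K] [NontriviallyNormedField L]
    [CharP L p] [Algebra K L] {X : Scheme.{u}} {f : X ⟶ Spec (.of K)} (g : Point f L → L) : Prop :=
  Continuous g ∧ AnalyticAfterWeilRestriction (k := PowSubfield p L) g

end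

noncomputable section

/-! ### Dense extensions of global function fields -/

section NormedFields

/-! Write `L` for the completion and `δ = θ ∘ d`. A derivation kills `p`-th powers, so `δ` is linear
over `L^p` but not over `L`; both halves of the theorem rest on this.

Differentials of `L`. `K` is separable over `F_p(s)` for some `s`, so its elements are separable
over `L^p(s)`; as their `p`-th powers lie in `L^p`, they lie in `L^p(s)`
(`adjoin_powSubfield_eq_top`). That field is finite over the complete field `L^p`, hence closed, and
`K` is dense, so `L = L^p(s)` and `ds` spans the differentials. If `ds = 0`, then `L` is unramified
and purely inseparable over `L^p`, so `L = L^p`. But `L` is finite over the closure of `F_p(t)`,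
whose value group is infinite cyclic, so a generator of that group cannot have `p^n`-th roots in `L`
for all `n`.

Analyticity. If `ω = ∑ a db` on an affine open, its value at `x` is `∑ a(x) δ(b(x))`. Since `δ` is
`L^p`-linear and `L` is finite over `L^p`, this is continuous, and a polynomial in the coordinates
of the Weil restriction.

Nonconstancy. In standard smooth coordinates `t_i`, write `ω = ∑ F_i dt_i + ∑ a_c dc` with constants
`c ∈ K`. By the inverse function theorem the coordinates `u` parametrize the nearby points. Along `u
+ r^p h` one has `δ(u + r^p h) = δ(u) + r^p δ(h)`, so the value is a differentiable function of
`r^p`; if it is constant, its derivative vanishes. All terms of that derivative are `L`-linear in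
`h` except `∑ F_i(x) δ(h_i)`, so comparing two proportional directions gives `F_i(x) = 0`
(`repr_relForm_eq_zero_of_eventually_const`). This holds at all nearby points, which forces `F_i =
0` (`eq_zero_of_eventually_apply_eq_zero`), and the vanishing of the relative form spreads from one
affine open to `X`. -/

lemma Submodule.eq_top_of_dense_of_finiteDimensional {k E : Type*} [NontriviallyNormedField k]
    [CompleteSpace k] [NormedAddCommGroup E] [NormedSpace k E] (M : Submodule k E)
    [FiniteDimensional k M] (h : Dense (M : Set E)) : M = ⊤ := by
  have := M.closed_of_finiteDimensional.closure_eq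
  rw [h.closure_eq] at this
  exact SetLike.coe_injective (by simpa using this.symm)

/-- Integers satisfy `n ^ p = n` in `L`, so their norms cannot exceed one. -/
lemma isUltrametricDist_of_charP (p : ℕ) [Fact p.Prime] (L : Type*) [NormedField L] [CharP L p] :
    IsUltrametricDist L := by
  refine IsUltrametricDist.isUltrametricDist_of_forall_norm_natCast_le_one fun n => ?_
  have h : (n : L) ^ p = n := by
    have := congrArg (ZMod.castHom dvd_rfl L) (ZMod.pow_card (n : ZMod p))
    rwa [map_pow, map_natCast] at this
  have h2 := congrArg norm h
  rw [norm_pow] at h2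
  by_contra! h3
  exact absurd h2 (lt_self_pow₀ h3 (Fact.out : p.Prime).one_lt).ne'

variable (p : ℕ) [Fact p.Prime]

/-- Frobenius raises distances to the power `p`, so the `p`-th roots of a Cauchy sequence form a
Cauchy sequence. -/
instance completeSpace_powSubfield (L : Type u) [NontriviallyNormedField L] [CompleteSpace L]
    [CharP L p] : CompleteSpace (PowSubfield p L) := by
  have hp : p ≠ 0 := (Fact.out : p.Prime).ne_zero
  refine Metric.complete_of_cauchySeq_tendsto fun a ha => ?_
  choose x hx using fun n => (a n).2
  have hd : ∀ m n, dist (a m) (a n) = dist (x m) (x n) ^ p := fun m n => by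
    rw [Subtype.dist_eq, dist_eq_norm, dist_eq_norm, ← norm_pow, sub_pow_char, ← hx m, ← hx n]
    rfl
  have hc : CauchySeq x := by
    rw [Metric.cauchySeq_iff] at ha ⊢
    intro ε hε
    obtain ⟨N, hN⟩ := ha (ε ^ p) (by positivity)
    refine ⟨N, fun m hm n hn => ?_⟩
    have := hN m hm n hn
    rw [hd] at this
    exact lt_of_pow_lt_pow_left₀ p hε.le this
  obtain ⟨y, hy⟩ := cauchySeq_tendsto_of_complete hc
  refine ⟨⟨y ^ p, y, rfl⟩, ?_⟩
  rw [tendsto_subtype_rng]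
  have : (fun n => ((a n : PowSubfield p L) : L)) = fun n => x n ^ p := funext fun n => (hx n).symm
  rw [this]
  exact hy.pow p

/-- A nontrivial ultrametric absolute value on a rational function field that is trivial on the
constants has an infinite cyclic value group. -/
lemma exists_norm_eq_zpow {k L : Type*} [Field k] [NormedField L] [IsUltrametricDist L]
    [Algebra (RatFunc k) L]
    (hk : ∀ c : k, c ≠ 0 → ‖algebraMap (RatFunc k) L (RatFunc.C c)‖ = 1)
    (hnt : ∃ x : RatFunc k, x ≠ 0 ∧ ‖algebraMap (RatFunc k) L x‖ ≠ 1) :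
    ∃ ϖ : RatFunc k, ϖ ≠ 0 ∧ ‖algebraMap (RatFunc k) L ϖ‖ ≠ 1 ∧ ∀ x : RatFunc k, x ≠ 0 →
      ∃ n : ℤ, ‖algebraMap (RatFunc k) L x‖ = ‖algebraMap (RatFunc k) L ϖ‖ ^ n := by
  let N : RatFunc k → ℝ := fun x => ‖algebraMap (RatFunc k) L x‖
  let P : Polynomial k → ℝ := fun q => N (algebraMap (Polynomial k) (RatFunc k) q)
  have Nmul : ∀ x y, N (x * y) = N x * N y := fun x y => by simp [N]
  have Pmul : ∀ x y, P (x * y) = P x * P y := fun x y => by simp [P, Nmul]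
  have P0 : P 0 = 0 := by simp [P, N]
  have Padd : ∀ x y, P (x + y) ≤ max (P x) (P y) := fun x y => by
    simp only [P, N, map_add]
    exact IsUltrametricDist.norm_add_le_max _ _
  have Paddlt : ∀ x y, P x < P y → P (x + y) = P y := fun x y h => by
    simp only [P, N, map_add] at h ⊢
    rw [IsUltrametricDist.norm_add_eq_max_of_norm_ne_norm h.ne, max_eq_right h.le]
  have PC : ∀ c : k, c ≠ 0 → P (Polynomial.C c) = 1 := fun c hc => by
    simpa [P, N] using hk c hc
  have Pne : ∀ q : Polynomial k, q ≠ 0 → 0 < P q := fun q hq => by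
    simpa [P, N] using hq
  suffices h : ∃ ϖ : Polynomial k, ϖ ≠ 0 ∧ P ϖ ≠ 1 ∧ ∀ q : Polynomial k, q ≠ 0 →
      ∃ n : ℕ, P q = P ϖ ^ n by
    obtain ⟨ϖ, h0, h1, h2⟩ := h
    refine ⟨algebraMap _ _ ϖ, by simpa using h0, h1, fun x hx => ?_⟩
    obtain ⟨a, b, hb, rfl⟩ := IsFractionRing.div_surjective (A := Polynomial k) x
    have hb0 := nonZeroDivisors.ne_zero hb
    have ha0 : a ≠ 0 := by
      rintro rfl
      simp at hx
    obtain ⟨m, hm⟩ := h2 a ha0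
    obtain ⟨n, hn⟩ := h2 b hb0
    refine ⟨m - n, ?_⟩
    rw [map_div₀, norm_div, zpow_sub₀ (Pne ϖ h0).ne', zpow_natCast, zpow_natCast]
    exact congrArg₂ (· / ·) hm hn
  -- As in Ostrowski's theorem: if `X` has value above one, the leading term dominates and the value
  -- depends only on the degree. Otherwise all polynomials have value at most one, and a polynomial
  -- of least degree with value different from one generates the value group.
  rcases lt_or_ge 1 (P Polynomial.X) with hX | hX
  · refine ⟨Polynomial.X, Polynomial.X_ne_zero, hX.ne', fun q hq => ⟨q.natDegree, ?_⟩⟩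
    induction hd : q.natDegree using Nat.strong_induction_on generalizing q with
    | _ d ih =>
      have hlead : P (Polynomial.C q.leadingCoeff * Polynomial.X ^ d) = P Polynomial.X ^ d := by
        have hpow : P (Polynomial.X ^ d) = P Polynomial.X ^ d := by simp [P, N]
        rw [Pmul, PC _ (by simpa using hq), one_mul, hpow]
      have hsum := Polynomial.eraseLead_add_C_mul_X_pow q
      rw [hd] at hsum
      by_cases he : q.eraseLead = 0
      · rw [← hsum, he, zero_add, hlead]
      · have hlt : q.eraseLead.natDegree < d := by
          have := Polynomial.eraseLead_natDegree_lt_or_eraseLead_eq_zero q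
          rw [hd] at this
          exact this.resolve_right he
        conv_lhs => rw [← hsum]
        rw [Paddlt, hlead]
        rw [hlead, ih _ hlt _ he rfl]
        exact pow_lt_pow_right₀ hX hlt
  · have Ple : ∀ q, P q ≤ 1 := fun q => by
      induction q using Polynomial.induction_on' with
      | add a b ha hb => exact (Padd a b).trans (max_le ha hb)
      | monomial n a =>
        by_cases ha : a = 0
        · simp [ha, P0]
        · have hpow : P (Polynomial.X ^ n) = P Polynomial.X ^ n := by simp [P, N]
          rw [← Polynomial.C_mul_X_pow_eq_monomial, Pmul, PC a ha, one_mul, hpow]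
          exact pow_le_one₀ (norm_nonneg _) hX
    have hex : ∃ n : ℕ, ∃ q : Polynomial k, q ≠ 0 ∧ P q ≠ 1 ∧ q.natDegree = n := by
      by_contra! hcon
      obtain ⟨x, hx, hx1⟩ := hnt
      obtain ⟨a, b, hb, rfl⟩ := IsFractionRing.div_surjective (A := Polynomial k) x
      have hb0 := nonZeroDivisors.ne_zero hb
      have ha0 : a ≠ 0 := by
        rintro rfl
        simp at hx
      apply hx1
      rw [map_div₀, norm_div]
      have e1 : P a = 1 := by
        by_contra h
        exact hcon _ a ha0 h rfl
      have e2 : P b = 1 := by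
        by_contra h
        exact hcon _ b hb0 h rfl
      change P a / P b = 1
      rw [e1, e2, div_one]
    classical
    obtain ⟨ϖ, h0, h1, hdeg⟩ := Nat.find_spec hex
    have hmin : ∀ q : Polynomial k, q ≠ 0 → q.natDegree < ϖ.natDegree → P q = 1 := by
      intro q hq hlt
      by_contra h
      rw [hdeg] at hlt
      exact Nat.find_min hex hlt ⟨q, hq, h, rfl⟩
    have hϖ : P ϖ < 1 := lt_of_le_of_ne (Ple _) h1
    refine ⟨ϖ, h0, h1, fun q hq => ?_⟩
    have hϖu : 0 < ϖ.natDegree := by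
      rw [Nat.pos_iff_ne_zero]
      intro h
      rw [Polynomial.natDegree_eq_zero] at h
      obtain ⟨c, rfl⟩ := h
      exact h1 (PC c (by simpa using h0))
    induction hd : q.natDegree using Nat.strong_induction_on generalizing q with
    | _ d ih =>
      -- A nonzero remainder has value one by minimality of `ϖ` and dominates the multiple of `ϖ`; a
      -- zero remainder lets the induction pass to the quotient.
      have hdm := EuclideanDomain.div_add_mod q ϖ
      by_cases hr : q % ϖ = 0
      · have hq' : q / ϖ ≠ 0 := by
          intro h
          rw [hr, h] at hdm
          simp at hdm
          exact hq hdm.symm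
        rw [hr, add_zero] at hdm
        have : (q / ϖ).natDegree < d := by
          rw [← hd, ← congrArg Polynomial.natDegree hdm, Polynomial.natDegree_mul h0 hq']
          omega
        obtain ⟨n, hn⟩ := ih _ this _ hq' rfl
        refine ⟨n + 1, ?_⟩
        rw [← hdm, Pmul, hn, pow_succ']
      · refine ⟨0, ?_⟩
        have hr1 : P (q % ϖ) = 1 :=
          hmin _ hr (Polynomial.natDegree_mod_lt _ hϖu.ne')
        rw [← hdm, Paddlt, hr1, pow_zero]
        rw [hr1, Pmul]
        calc P ϖ * P (q / ϖ) ≤ P ϖ * 1 := by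
              exact mul_le_mul_of_nonneg_left (Ple _) (norm_nonneg _)
          _ < 1 := by rwa [mul_one]

end NormedFields

/-! ### Imperfection of the completion -/

section NotPerfect

variable (p : ℕ) [Fact p.Prime]

/-- Nonzero elements of a finite field are roots of unity. -/
lemma norm_map_eq_one_of_finite {k L : Type*} [Field k] [Finite k] [NormedField L]
    (φ : k →+* L) {c : k} (hc : c ≠ 0) : ‖φ c‖ = 1 := by
  have := Fintype.ofFinite k
  have h := congrArg (fun x => ‖φ x‖) (FiniteField.pow_card_sub_one_eq_one c hc)
  simp only [map_pow, norm_pow, map_one, norm_one] at h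
  have h1 : 1 < Fintype.card k := Fintype.one_lt_card
  exact (pow_eq_one_iff_of_nonneg (norm_nonneg _) (by omega)).mp h

/-- If `L` is dense over an algebraic extension of `E`, its absolute value is nontrivial on `E`. -/
lemma exists_norm_ne_one {E K L : Type*} [Field E] [Field K] [Algebra E K] [Algebra.IsIntegral E K]
    [NontriviallyNormedField L] [IsUltrametricDist L] [Algebra K L] [Algebra E L]
    [IsScalarTower E K L] (hd : DenseRange (algebraMap K L)) :
    ∃ x : E, x ≠ 0 ∧ ‖algebraMap E L x‖ ≠ 1 := by
  by_contra! hcon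
  obtain ⟨z, hz⟩ := NontriviallyNormedField.non_trivial (α := L)
  obtain ⟨x, hx⟩ := hd.exists_mem_open (isOpen_lt continuous_const continuous_norm) ⟨z, hz⟩
  have hint : IsIntegral E (algebraMap K L x) := (Algebra.IsIntegral.isIntegral x).algebraMap
  let V := (NormedField.valuation (K := L))
  have hle : ∀ y : L, y ∈ V.integer ↔ ‖y‖ ≤ 1 := fun y => by
    rw [Valuation.mem_integer_iff]
    rfl
  -- If the norm were trivial on `E`, then `E` would lie in the valuation ring, which is integrally
  -- closed and so would contain `K`; but `x` has norm above one.
  have : algebraMap K L x ∈ V.integer := by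
    refine (Valuation.integer.integers V).mem_of_integral ?_
    obtain ⟨q, hq, hq0⟩ := hint
    have hE : ∀ e : E, algebraMap E L e ∈ V.integer := fun e => by
      rw [hle]
      by_cases he : e = 0
      · simp [he]
      · exact (hcon e he).le
    refine ⟨q.map ((algebraMap E L).codRestrict V.integer hE), hq.map _, ?_⟩
    rw [Polynomial.eval₂_map]
    exact hq0
  rw [hle] at this
  exact absurd hx (not_lt.mpr this)

/-- A field which is finite over a complete subfield with discrete value group is not perfect. -/
lemma powSubfield_ne_top_of_finite {F L : Type*} [Field F] [NontriviallyNormedField L]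
    [CharP L p] [Algebra F L] [FiniteDimensional F L] (ϖ : F) (h0 : ϖ ≠ 0)
    (h1 : ‖algebraMap F L ϖ‖ ≠ 1)
    (h : ∀ x : F, x ≠ 0 → ∃ n : ℤ, ‖algebraMap F L x‖ = ‖algebraMap F L ϖ‖ ^ n) :
    PowSubfield p L ≠ ⊤ := by
  intro htop
  have hp := (Fact.out : p.Prime)
  have hsurj : Function.Surjective (frobenius L p) := RingHom.fieldRange_eq_top_iff.mp htop
  have hroot : ∀ n : ℕ, ∃ y : L, y ^ p ^ n = algebraMap F L ϖ := fun n => by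
    obtain ⟨y, hy⟩ := hsurj.iterate n (algebraMap F L ϖ)
    exact ⟨y, by rw [← hy, iterate_frobenius]⟩
  -- For a `p^n`-th root `y` of `ϖ`, the field norm gives `N(y)^(p^n) = ϖ^[L:F]`. Comparing
  -- exponents in the value group, `p^n` divides `[L:F]`, so any `n` with `p^n > [L:F]` is
  -- contradictory.
  obtain ⟨n, hn⟩ := pow_unbounded_of_one_lt (Module.finrank F L) hp.one_lt
  obtain ⟨y, hy⟩ := hroot n
  have hN := congrArg (Algebra.norm F) hy
  rw [map_pow, Algebra.norm_algebraMap] at hN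
  have hy0 : Algebra.norm F y ≠ 0 := by
    intro h
    rw [h, zero_pow (pow_pos hp.pos n).ne'] at hN
    exact pow_ne_zero _ h0 hN.symm
  obtain ⟨m, hm⟩ := h _ hy0
  have h2 := congrArg (fun x => ‖algebraMap F L x‖) hN
  simp only [map_pow, norm_pow, hm] at h2
  rw [← zpow_natCast, ← zpow_natCast, ← zpow_mul] at h2
  have h3 := zpow_right_injective₀ (norm_pos_iff.mpr (by simpa using h0)) h1 h2
  have hd : 0 < Module.finrank F L := Module.finrank_pos
  have hdvd : ((p ^ n : ℕ) : ℤ) ∣ (Module.finrank F L : ℤ) := ⟨m, by rw [← h3, mul_comm]⟩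
  rw [Int.natCast_dvd_natCast] at hdvd
  exact absurd (Nat.le_of_dvd hd hdvd) (not_le.mpr hn)

/-- If `L` is complete and `K` is dense in `L` and finite over a subfield `E` with discrete value
group, then `L` is not perfect. -/
lemma powSubfield_ne_top_of_dense {E K L : Type*} [Field E] [Field K] [Algebra E K]
    [FiniteDimensional E K] [NontriviallyNormedField L] [CharP L p] [CompleteSpace L]
    [IsUltrametricDist L] [Algebra K L] [Algebra E L] [IsScalarTower E K L]
    (hd : DenseRange (algebraMap K L)) (ϖ : E) (h0 : ϖ ≠ 0) (h1 : ‖algebraMap E L ϖ‖ ≠ 1)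
    (h : ∀ x : E, x ≠ 0 → ∃ n : ℤ, ‖algebraMap E L x‖ = ‖algebraMap E L ϖ‖ ^ n) :
    PowSubfield p L ≠ ⊤ := by
  let F : Subfield L := (algebraMap E L).fieldRange.topologicalClosure
  have hEF : ∀ e : E, algebraMap E L e ∈ F := fun e =>
    Subfield.le_topologicalClosure _ ⟨e, rfl⟩
  have hϖL : algebraMap E L ϖ ≠ 0 := by simpa using h0
  let ϖ' : F := ⟨algebraMap E L ϖ, hEF ϖ⟩
  have hϖ' : ϖ' ≠ 0 := fun h => hϖL (congrArg Subtype.val h)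
  let _ : NontriviallyNormedField F :=
    { (inferInstance : NormedField F) with
      non_trivial := by
        rcases lt_or_gt_of_ne h1 with hlt | hgt
        · refine ⟨ϖ'⁻¹, ?_⟩
          change 1 < ‖(ϖ'⁻¹ : F)‖
          rw [norm_inv]
          exact (one_lt_inv₀ (norm_pos_iff.mpr hϖ')).mpr hlt
        · exact ⟨ϖ', hgt⟩ }
  have hcomplete : CompleteSpace F :=
    (Subfield.isClosed_topologicalClosure _).completeSpace_coe
  let _ : NormedSpace F L := { norm_smul_le := fun a x => (norm_mul a.1 x).le }
  have hfin : FiniteDimensional F L := by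
    obtain ⟨s, hs⟩ := (Module.Finite.fg_top (R := E) (M := K))
    let M : Submodule F L := Submodule.span F (algebraMap K L '' s)
    have : FiniteDimensional F M :=
      FiniteDimensional.span_of_finite F (s.finite_toSet.image _)
    -- `M` is finite-dimensional over the complete field `F`, hence closed, and it contains the
    -- dense image of `K`.
    have hM : M = ⊤ := by
      refine M.eq_top_of_dense_of_finiteDimensional (hd.mono ?_)
      rintro _ ⟨x, rfl⟩
      have hx : x ∈ Submodule.span E (s : Set K) := hs ▸ Submodule.mem_top
      induction hx using Submodule.span_induction with
      | mem x hx => exact Submodule.subset_span ⟨x, hx, rfl⟩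
      | zero => simp
      | add x y _ _ hx hy =>
        rw [map_add]
        exact M.add_mem hx hy
      | smul e x _ hx =>
        have : algebraMap K L (e • x) = (⟨algebraMap E L e, hEF e⟩ : F) • algebraMap K L x := by
          rw [Algebra.smul_def, map_mul, ← IsScalarTower.algebraMap_apply]
          rfl
        rw [this]
        exact M.smul_mem _ hx
    exact Module.finite_def.mpr (hM ▸ Module.Finite.iff_fg.mp this)
  refine powSubfield_ne_top_of_finite p ϖ' hϖ' h1 fun x hx => ?_
  have hx0 : (x : L) ≠ 0 := fun h => hx (Subtype.ext h)
  have hxF : (x : L) ∈ closure (Set.range (algebraMap E L)) := x.2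
  obtain ⟨_, ⟨e, rfl⟩, he⟩ := Metric.mem_closure_iff.mp hxF ‖(x : L)‖ (norm_pos_iff.mpr hx0)
  rw [dist_eq_norm] at he
  -- By the ultrametric inequality, passing to the closure adds no new values.
  have hne : ‖(x : L)‖ = ‖algebraMap E L e‖ := by
    rw [sub_eq_add_neg] at he
    rw [IsUltrametricDist.norm_eq_of_add_norm_lt_max (he.trans_le (le_max_left _ _)), norm_neg]
  have he0 : e ≠ 0 := by
    rintro rfl
    rw [map_zero, norm_zero, norm_eq_zero] at hne
    exact hx0 hne
  obtain ⟨n, hn⟩ := h e he0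
  exact ⟨n, hne.trans hn⟩

end NotPerfect

/-! ### Generation over the `p`-th powers, and the differentials -/

section Generation

/-- A finite extension of a rational function field in one variable over a perfect field `k` is
separable over `k(s)` for some `s`. -/
lemma exists_isSeparable_adjoin_simple (k K : Type*) [Field k] [PerfectField k] [Field K]
    [Algebra k K] [Algebra (RatFunc k) K] [IsScalarTower k (RatFunc k) K]
    [FiniteDimensional (RatFunc k) K] :
    ∃ s : K, Algebra.IsSeparable (IntermediateField.adjoin k ({s} : Set K)) K := by
  have h0 : Algebra.EssFiniteType (Polynomial k) (RatFunc k) :=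
    Algebra.EssFiniteType.of_isLocalization _ (nonZeroDivisors (Polynomial k))
  have h1 : Algebra.EssFiniteType k (RatFunc k) :=
    Algebra.EssFiniteType.comp k (Polynomial k) (RatFunc k)
  have h2 : Algebra.EssFiniteType k K := Algebra.EssFiniteType.comp k (RatFunc k) K
  obtain ⟨s, hs, hsep⟩ := exists_isTranscendenceBasis_and_isSeparable_of_perfectField k K
  have halg : Algebra.IsAlgebraic (Polynomial k) (RatFunc k) :=
    IsLocalization.isAlgebraic _ (nonZeroDivisors (Polynomial k))
  -- The variable is another transcendence basis of `K`, so the separating one also has a single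
  -- element.
  have h3 := ((IsTranscendenceBasis.polynomial Unit k).algebraMap_comp
    (A := RatFunc k)).algebraMap_comp (A := K)
  have h4 := hs.lift_cardinalMk_eq h3
  have h5 : s.card = 1 := by simpa using h4
  obtain ⟨t, rfl⟩ := Finset.card_eq_one.mp h5
  rw [Finset.coe_singleton] at hsep
  exact ⟨t, hsep⟩

/-- If `L` is complete and `K` is dense in `L` and separable over `k(s)`, then `L = L^p(s)`. -/
lemma adjoin_powSubfield_eq_top (p : ℕ) [Fact p.Prime] {k : Type*} {K L : Type u} [Field k] [PerfectField k]
    [CharP k p]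
    [Field K] [NontriviallyNormedField L] [CompleteSpace L] [CharP L p] [Algebra k K]
    [Algebra K L] (hd : DenseRange (algebraMap K L)) (s : K)
    [hs : Algebra.IsSeparable (IntermediateField.adjoin k ({s} : Set K)) K] :
    Module.Finite (PowSubfield p L) L ∧
      Algebra.adjoin (PowSubfield p L) {algebraMap K L s} = ⊤ := by
  let P := PowSubfield p L
  have hpow : ∀ x : L, x ^ p ∈ P := fun x => ⟨x, rfl⟩
  have hint : IsIntegral P (algebraMap K L s) := by
    refine IsIntegral.of_pow (Fact.out : p.Prime).pos ?_
    exact isIntegral_algebraMap (x := (⟨_, hpow _⟩ : P))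
  let S := IntermediateField.adjoin P {algebraMap K L s}
  have hfin : FiniteDimensional P S := IntermediateField.adjoin.finiteDimensional hint
  -- Constants are `p`-th powers because `k` is perfect; hence `k(s)` maps into `S`.
  have hk : ∀ c : k, algebraMap K L (algebraMap k K c) ∈ P := fun c => by
    obtain ⟨d, rfl⟩ := surjective_frobenius k p c
    rw [frobenius_def, map_pow, map_pow]
    exact hpow _
  have hE : ∀ e ∈ IntermediateField.adjoin k ({s} : Set K), algebraMap K L e ∈ S := by
    intro e he
    have : IntermediateField.adjoin k ({s} : Set K) ≤
        { S.toSubfield.comap (algebraMap K L) with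
          algebraMap_mem' := fun c => S.algebraMap_mem ⟨_, hk c⟩ } :=
      IntermediateField.adjoin_le_iff.mpr (by
        rintro _ rfl
        exact IntermediateField.mem_adjoin_simple_self P _)
    exact this he
  -- Over `S` the element `x` is separable, since it is so over `k(s)`, and purely inseparable,
  -- since `x ^ p` lies in `L^p`; so it lies in `S`.
  have hK : ∀ x : K, algebraMap K L x ∈ S := by
    intro x
    let E := IntermediateField.adjoin k ({s} : Set K)
    let i : E →+* S :=
      ((algebraMap K L).comp (algebraMap E K)).codRestrict S.toSubfield fun e => hE e.1 e.2
    have hi : (algebraMap S L).comp i = (algebraMap K L).comp (algebraMap E K) := rfl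
    have hchar : ExpChar S p := by
      have : CharP S p := ((algebraMap S L).charP_iff (algebraMap S L).injective p).mpr ‹_›
      exact .prime Fact.out
    have hsep : IsSeparable S (algebraMap K L x) := by
      have h1 : (minpoly E x).Separable := hs.isSeparable' x
      have h2 : minpoly S (algebraMap K L x) ∣ (minpoly E x).map i := by
        refine minpoly.dvd _ _ ?_
        rw [Polynomial.aeval_def, Polynomial.eval₂_map, hi, ← Polynomial.hom_eval₂,
          ← Polynomial.aeval_def, minpoly.aeval, map_zero]
      exact h1.map.of_dvd h2
    have hp : algebraMap K L x ^ p ∈ (algebraMap S L).range :=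
      ⟨⟨_, S.algebraMap_mem (⟨_, hpow _⟩ : P)⟩, rfl⟩
    have hsub : (IntermediateField.adjoin S {algebraMap K L x}) = ⊥ := by
      have := (IntermediateField.isSeparable_adjoin_simple_iff_isSeparable S L).mpr hsep
      have : IsPurelyInseparable S (IntermediateField.adjoin S {algebraMap K L x}) :=
        (IntermediateField.isPurelyInseparable_adjoin_simple_iff_pow_mem S L p).mpr
          ⟨1, by rwa [pow_one]⟩
      exact IntermediateField.eq_bot_of_isPurelyInseparable_of_isSeparable _
    have hmem := IntermediateField.mem_adjoin_simple_self S (algebraMap K L x)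
    rw [hsub, IntermediateField.mem_bot] at hmem
    obtain ⟨y, hy⟩ := hmem
    rw [← hy]
    exact y.2
  have htop : S.toSubalgebra.toSubmodule = ⊤ := by
    have : FiniteDimensional P S.toSubalgebra.toSubmodule := hfin
    refine Submodule.eq_top_of_dense_of_finiteDimensional _ (hd.mono ?_)
    rintro _ ⟨x, rfl⟩
    exact hK x
  refine ⟨Module.finite_def.mpr ?_, ?_⟩
  · rw [← htop]
    exact Module.Finite.iff_fg.mp hfin
  · rw [← IntermediateField.adjoin_simple_toSubalgebra_of_isAlgebraic hint.isAlgebraic]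
    exact Subalgebra.toSubmodule_injective htop

/-- If `L = L^p(s)` is not perfect, its differentials are one-dimensional. -/
lemma nonempty_kaehlerDifferential_equiv (p : ℕ) [Fact p.Prime] {L : Type u} [Field L] [CharP L p]
    (s : L) [Module.Finite (PowSubfield p L) L]
    (hs : Algebra.adjoin (PowSubfield p L) {s} = ⊤) (hp : PowSubfield p L ≠ ⊤) :
    Nonempty (Ω[L⁄ℤ] ≃ₗ[L] L) := by
  have hpow : ∀ c : PowSubfield p L, KaehlerDifferential.D ℤ L c = 0 := by
    rintro ⟨_, c, rfl⟩
    change KaehlerDifferential.D ℤ L (c ^ p) = 0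
    rw [Derivation.leibniz_pow, ← Nat.cast_smul_eq_nsmul L, CharP.cast_eq_zero, zero_smul]
  have hspan : ∀ x : L, KaehlerDifferential.D ℤ L x ∈
      Submodule.span L {KaehlerDifferential.D ℤ L s} := by
    intro x
    have hx : x ∈ Algebra.adjoin (PowSubfield p L) {s} := hs ▸ trivial
    induction hx using Algebra.adjoin_induction with
    | mem x hx =>
      obtain rfl := hx
      exact Submodule.mem_span_singleton_self _
    | algebraMap c =>
      rw [show algebraMap (PowSubfield p L) L c = (c : L) from rfl, hpow]
      exact zero_mem _
    | add x y _ _ hx hy =>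
      rw [map_add]
      exact add_mem hx hy
    | mul x y _ _ hx hy =>
      rw [Derivation.leibniz]
      exact add_mem (Submodule.smul_mem _ _ hy) (Submodule.smul_mem _ _ hx)
  have htop : Submodule.span L {KaehlerDifferential.D ℤ L s} = ⊤ := by
    rw [eq_top_iff, ← KaehlerDifferential.span_range_derivation, Submodule.span_le]
    rintro _ ⟨x, rfl⟩
    exact hspan x
  -- If `ds = 0`, all differentials vanish, so `L` is formally unramified over `L^p`; being also
  -- purely inseparable, it equals `L^p`.
  have hne : KaehlerDifferential.D ℤ L s ≠ 0 := by
    intro h0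
    apply hp
    rw [h0, Submodule.span_zero_singleton] at htop
    have : Subsingleton (Ω[L⁄ℤ]) := (Submodule.subsingleton_iff L).mp (subsingleton_of_bot_eq_top htop)
    have : Subsingleton (Ω[L⁄PowSubfield p L]) :=
      (KaehlerDifferential.map_surjective ℤ (PowSubfield p L) L).subsingleton
    have hunr : Algebra.FormallyUnramified (PowSubfield p L) L := ⟨this⟩
    have hexp : ExpChar (PowSubfield p L) p := by
      have : CharP (PowSubfield p L) p :=
        ((algebraMap (PowSubfield p L) L).charP_iff (RingHom.injective _) p).mpr ‹_›
      exact .prime Fact.out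
    have hpi : IsPurelyInseparable (PowSubfield p L) L :=
      (isPurelyInseparable_iff_pow_mem _ p).mpr fun x => ⟨1, ⟨⟨x ^ p, x, rfl⟩, by simp; rfl⟩⟩
    have := Algebra.FormallyUnramified.range_eq_top_of_isPurelyInseparable (PowSubfield p L) L
    rw [eq_top_iff]
    intro x _
    have hx : x ∈ (algebraMap (PowSubfield p L) L).range := this ▸ trivial
    obtain ⟨y, rfl⟩ := hx
    exact y.2
  exact ⟨((LinearEquiv.toSpanNonzeroSingleton L _ _ hne).trans
    ((LinearEquiv.ofEq _ _ htop).trans Submodule.topEquiv)).symm⟩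

end Generation

/-! ### The completion of a global function field -/

namespace Place

variable {K : Type u} [Field K] (v : Place K)

instance : CompleteSpace v.Completion := inferInstanceAs (CompleteSpace v.abv.Completion)

lemma denseRange_algebraMap : DenseRange (algebraMap K v.Completion) := by
  have h : DenseRange ((↑) : WithAbs v.abv → v.abv.Completion) :=
    UniformSpace.Completion.denseRange_coe
  refine h.mono ?_
  rintro _ ⟨x, rfl⟩
  exact ⟨x.ofAbs, rfl⟩

/-- The completion of a global function field of characteristic `p` is not perfect, and it is
generated by one element over its subfield of `p`-th powers. -/
theorem exists_adjoin_powSubfield_eq_top (p : ℕ) [Fact p.Prime] [CharP K p]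
    [Algebra (RatFunc (ZMod p)) K] [FunctionField (ZMod p) K] :
    Module.Finite (PowSubfield p v.Completion) v.Completion ∧
      PowSubfield p v.Completion ≠ ⊤ ∧
      ∃ s : v.Completion, Algebra.adjoin (PowSubfield p v.Completion) {s} = ⊤ := by
  have hd := v.denseRange_algebraMap
  have hu := isUltrametricDist_of_charP p v.Completion
  let _ : Algebra (ZMod p) K :=
    ((algebraMap (RatFunc (ZMod p)) K).comp (algebraMap (ZMod p) (RatFunc (ZMod p)))).toAlgebra
  have : IsScalarTower (ZMod p) (RatFunc (ZMod p)) K := IsScalarTower.of_algebraMap_eq fun _ => rfl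
  have hfin : FiniteDimensional (RatFunc (ZMod p)) K := ‹FunctionField (ZMod p) K›
  obtain ⟨s, hs⟩ := exists_isSeparable_adjoin_simple (ZMod p) K
  obtain ⟨h1, h2⟩ := adjoin_powSubfield_eq_top p (k := ZMod p) hd s
  refine ⟨h1, ?_, _, h2⟩
  let _ : Algebra (RatFunc (ZMod p)) v.Completion :=
    ((algebraMap K v.Completion).comp (algebraMap (RatFunc (ZMod p)) K)).toAlgebra
  have : IsScalarTower (RatFunc (ZMod p)) K v.Completion :=
    IsScalarTower.of_algebraMap_eq fun _ => rfl
  obtain ⟨ϖ, h3, h4, h5⟩ := exists_norm_eq_zpow (k := ZMod p) (L := v.Completion)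
    (fun c hc => norm_map_eq_one_of_finite
      ((algebraMap (RatFunc (ZMod p)) v.Completion).comp RatFunc.C) hc)
    (exists_norm_ne_one hd)
  exact powSubfield_ne_top_of_dense p hd ϖ h3 h4 h5

end Place

/-! ### Derivations along points -/

section Derivations

/-- The derivation `θ ∘ d` that corresponds to a linear form `θ` on the differentials. -/
def formDerivation {L : Type u} [Field L] (θ : Ω[L⁄ℤ] →ₗ[L] L) : Derivation ℤ L L :=
  θ.compDer (KaehlerDifferential.D ℤ L)

lemma derivation_pow_mul (p : ℕ) {L : Type u} [Field L] [CharP L p]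
    (δ : Derivation ℤ L L) (c x : L) : δ (c ^ p * x) = c ^ p * δ x := by
  rw [Derivation.leibniz, Derivation.leibniz_pow, ← Nat.cast_smul_eq_nsmul L, CharP.cast_eq_zero,
    zero_smul, smul_zero, add_zero, smul_eq_mul]

/-- A derivation of a field of characteristic `p` is linear over the subfield of `p`-th powers. -/
def Derivation.powLinear (p : ℕ) [Fact p.Prime] {L : Type u} [Field L] [CharP L p]
    (δ : Derivation ℤ L L) : L →ₗ[PowSubfield p L] L where
  toFun := δ
  map_add' := map_add δ
  map_smul' := by
    rintro ⟨_, c, rfl⟩ x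
    exact derivation_pow_mul p δ c x

/-- Over the complete field `L^p` the derivation is a linear map on a finite-dimensional space. -/
lemma continuous_derivation (p : ℕ) [Fact p.Prime] {L : Type u} [NontriviallyNormedField L]
    [CompleteSpace L] [CharP L p] [Module.Finite (PowSubfield p L) L] (δ : Derivation ℤ L L) :
    Continuous δ :=
  (δ.powLinear p).continuous_of_finiteDimensional

/-- The pullback of a 1-form along a point, in terms of a representation of the form. -/
lemma exists_sum_pullForm {A : Type u} [CommRing A] (η : Ω[A⁄ℤ]) :
    ∃ s : A →₀ A, ∀ (L : Type u) [Field L] (θ : Ω[L⁄ℤ] →ₗ[L] L) (φ : A →+* L),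
      θ (pullForm φ η) = s.sum fun b a => φ a * formDerivation θ (φ b) := by
  obtain ⟨s, hs⟩ := KaehlerDifferential.linearCombination_surjective ℤ A η
  refine ⟨s, fun L _ θ φ => ?_⟩
  rw [← hs, Finsupp.linearCombination_apply, Finsupp.sum, map_sum, map_sum]
  refine Finset.sum_congr rfl fun b _ => ?_
  rw [pullForm_smul, pullForm_D, map_smul]
  rfl

variable {K : Type u} [Field K] {X : Scheme.{u}} {f : X ⟶ Spec (.of K)}

/-- The topology on `X(L)` is the final one for the affine charts, and on a chart the value is a
finite sum `∑ a(φ) δ(b(φ))` with `δ` continuous. -/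
lemma continuous_eval (p : ℕ) [Fact p.Prime] {L : Type u} [NontriviallyNormedField L]
    [CompleteSpace L] [CharP L p] [Module.Finite (PowSubfield p L) L] [Algebra K L]
    (ω : GlobalForms f) (θ : Ω[L⁄ℤ] →ₗ[L] L) :
    Continuous fun x : Point f L => θ (GlobalForms.eval ω x) := by
  rw [continuous_iSup_dom]
  intro U
  rw [continuous_coinduced_dom]
  obtain ⟨s, hs⟩ := exists_sum_pullForm (ω.1 U)
  let _ := affineTopology f L U.1
  have hev : ∀ a : Sec f U.1, Continuous fun φ : Sec f U.1 →ₐ[K] L => φ a := fun a =>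
    (continuous_apply a).comp continuous_induced_dom
  have : (fun x : Point f L => θ (GlobalForms.eval ω x)) ∘ Point.ofHom U.2 =
      fun φ : Sec f U.1 →ₐ[K] L => s.sum fun b a => φ a * formDerivation θ (φ b) := by
    ext φ
    rw [Function.comp_apply, GlobalForms.eval_ofHom, hs]
    rfl
  rw [this]
  exact continuous_finsetSum _ fun b _ =>
    (hev _).mul ((continuous_derivation p (formDerivation θ)).comp (hev b))

end Derivations

/-! ### Analyticity on the Weil restriction -/

section Analytic

namespace WeilRes

variable {k L : Type u} [Field k] [Field L] [Algebra k L] {n : ℕ} (b : Module.Basis (Fin n) k L)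
  {B : Type u} [CommRing B] [Algebra L B]

lemma adjoin_coord_eq_top :
    Algebra.adjoin k (Set.range fun q : B × Fin n => coord b q.1 q.2) = ⊤ := by
  have h : (mk b B).range = ⊤ := (AlgHom.range_eq_top _).mpr (Ideal.Quotient.mkₐ_surjective _ _)
  rw [← h, ← Algebra.map_top, ← MvPolynomial.adjoin_range_X, AlgHom.map_adjoin, ← Set.range_comp]
  rfl

/-- The coordinates of generators of `B` generate the Weil restriction. -/
lemma adjoin_coord_of_adjoin_eq_top {S : Set B} (hS : Algebra.adjoin L S = ⊤) :
    Algebra.adjoin k (Set.range fun q : S × Fin n => coord b q.1.1 q.2) = ⊤ := by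
  rw [eq_top_iff, ← adjoin_coord_eq_top b, Algebra.adjoin_le_iff]
  rintro _ ⟨⟨x, i⟩, rfl⟩
  have hx : x ∈ Algebra.adjoin L S := hS ▸ trivial
  change coord b x i ∈ _
  induction hx using Algebra.adjoin_induction generalizing i with
  | mem x hx => exact Algebra.subset_adjoin ⟨⟨⟨x, hx⟩, i⟩, rfl⟩
  | algebraMap c =>
    rw [coord_scalar]
    exact Subalgebra.algebraMap_mem _ _
  | add x y _ _ hx hy =>
    rw [coord_add]
    exact add_mem (hx i) (hy i)
  | mul x y _ _ hx hy =>
    rw [coord_mul]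
    exact sum_mem fun j _ => sum_mem fun l _ => Subalgebra.smul_mem _ (mul_mem (hx j) (hy l)) _

/-- This supplies the closed embedding into affine space demanded by `AnalyticAtPoint`. -/
lemma exists_generators [Algebra.FiniteType L B] :
    ∃ (N : ℕ) (a : Fin N → Ring b B), Algebra.adjoin k (Set.range a) = ⊤ := by
  obtain ⟨S, hS⟩ := ‹Algebra.FiniteType L B›.out
  let e := (Fintype.equivFin (S × Fin n)).symm
  refine ⟨_, fun j => coord b (e j).1.1 (e j).2, ?_⟩
  rw [← adjoin_coord_of_adjoin_eq_top b hS]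
  congr 1
  exact e.surjective.range_comp fun q : S × Fin n => coord b q.1.1 q.2

lemma toPoint_apply (ψ : Ring b B →ₐ[k] k) (x : B) :
    toPoint b B ψ x = ∑ i, ψ (coord b x i) • b i := by
  simp [toPoint, toHom_apply]

end WeilRes

lemma analyticAt_aeval_smul {k E : Type*} [NontriviallyNormedField k] [NormedAddCommGroup E]
    [NormedSpace k E] {N : ℕ} (P : MvPolynomial (Fin N) k) (c : E) (y : Fin N → k) :
    AnalyticAt k (fun y => MvPolynomial.aeval y P • c) y :=
  (AnalyticAt.aeval_mvPolynomial (f := fun y : Fin N → k => y)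
    (fun i => (ContinuousLinearMap.proj (R := k) (φ := fun _ : Fin N => k) i).analyticAt y) P).smul
    analyticAt_const

/-- Linear combinations of regular functions with vector coefficients are analytic. -/
lemma analyticAtPoint_sum {k A E : Type*} [NontriviallyNormedField k] [CommRing A] [Algebra k A]
    [NormedAddCommGroup E] [NormedSpace k E]
    (hA : ∃ (N : ℕ) (a : Fin N → A), Algebra.adjoin k (Set.range a) = ⊤)
    {ι : Type*} (s : Finset ι) (r : ι → A) (c : ι → E) (ψ : A →ₐ[k] k) :
    AnalyticAtPoint (fun χ : A →ₐ[k] k => ∑ i ∈ s, χ (r i) • c i) ψ := by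
  obtain ⟨N, a, ha⟩ := hA
  have hsurj : ∀ x : A, ∃ P : MvPolynomial (Fin N) k, MvPolynomial.aeval a P = x := by
    intro x
    have : x ∈ Algebra.adjoin k (Set.range a) := ha ▸ trivial
    rwa [Algebra.adjoin_range_eq_range_aeval] at this
  choose P hP using hsurj
  refine ⟨N, a, ha, fun y => ∑ i ∈ s, MvPolynomial.aeval y (P (r i)) • c i, ?_, ?_⟩
  · exact Finset.analyticAt_fun_sum s fun i _ => analyticAt_aeval_smul _ _ _
  · refine Filter.Eventually.of_forall fun y χ hχ => Finset.sum_congr rfl fun i _ => ?_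
    rw [← hχ]
    congr 1
    conv_lhs => rw [← hP (r i)]
    exact (MvPolynomial.comp_aeval_apply _ χ (P (r i)))

variable {K : Type u} [Field K] {X : Scheme.{u}} {f : X ⟶ Spec (.of K)}

/-- Expand both factors of `a(x) δ(c(x))` in the basis `b`. By `L^p`-linearity of `δ` the product is
bilinear in the Weil coordinates, with constant coefficients `b_i δ(b_j)` in `L`; so the function is
even polynomial. -/
lemma analyticAfterWeilRestriction_eval (p : ℕ) [Fact p.Prime] {L : Type u}
    [NontriviallyNormedField L] [CharP L p] [Module.Finite (PowSubfield p L) L] [Algebra K L]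
    (hft : ∀ U : X.affineOpens, Algebra.FiniteType K (Sec f U.1))
    (ω : GlobalForms f) (θ : Ω[L⁄ℤ] →ₗ[L] L) :
    AnalyticAfterWeilRestriction (k := PowSubfield p L)
      fun x : Point f L => θ (GlobalForms.eval ω x) := by
  let b := Module.finBasis (PowSubfield p L) L
  refine ⟨_, b, fun U ψ => ?_⟩
  have := hft U
  obtain ⟨s, hs⟩ := exists_sum_pullForm (ω.1 U)
  let δ := formDerivation θ
  let R := WeilRes.Ring b (L ⊗[K] Sec f U.1)
  let x : Sec f U.1 → Fin _ → R := fun a i => WeilRes.coord b (1 ⊗ₜ[K] a) i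
  have key : (fun χ : R →ₐ[PowSubfield p L] PowSubfield p L => θ (GlobalForms.eval ω (Point.ofHom U.2
        (((WeilRes.toPoint b (L ⊗[K] Sec f U.1) χ).restrictScalars K).comp
          Algebra.TensorProduct.includeRight)))) =
      fun χ => ∑ t ∈ s.support ×ˢ (Finset.univ ×ˢ Finset.univ),
        χ (x (s t.1) t.2.1 * x t.1 t.2.2) • (b t.2.1 * δ (b t.2.2)) := by
    ext χ
    have hpt : ∀ a : Sec f U.1, WeilRes.toPoint b (L ⊗[K] Sec f U.1) χ (1 ⊗ₜ[K] a) =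
      ∑ i, χ (x a i) • b i := fun a => WeilRes.toPoint_apply b χ _
    rw [GlobalForms.eval_ofHom, hs, Finsupp.sum, Finset.sum_product]
    refine Finset.sum_congr rfl fun a _ => ?_
    change WeilRes.toPoint b (L ⊗[K] Sec f U.1) χ (1 ⊗ₜ[K] s a) *
      δ.powLinear p (WeilRes.toPoint b (L ⊗[K] Sec f U.1) χ (1 ⊗ₜ[K] a)) = _
    rw [hpt, hpt, map_sum, Finset.sum_mul_sum, Finset.sum_product]
    refine Finset.sum_congr rfl fun i _ => Finset.sum_congr rfl fun j _ => ?_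
    rw [map_smul, smul_mul_smul_comm, map_mul]
    rfl
  change AnalyticAtPoint (fun χ : R →ₐ[PowSubfield p L] PowSubfield p L => _) ψ
  rw [key]
  exact analyticAtPoint_sum (WeilRes.exists_generators b) _ _ _ _

end Analytic

/-! ### Local parametrization of the points of a smooth algebra -/

section LocalPoints

variable {K A L : Type*} [Field K] [CommRing A] [Algebra K A] [NontriviallyNormedField L]
  [Algebra K L] {ι σ : Type*}

/-- Strict differentiability is what the inverse function theorem requires. -/
lemma MvPolynomial.hasStrictFDerivAt_aeval [Fintype ι] (q : MvPolynomial ι K) (z : ι → L) :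
    HasStrictFDerivAt (fun z : ι → L => MvPolynomial.aeval z q)
      (∑ i, MvPolynomial.aeval z (MvPolynomial.pderiv i q) •
        ContinuousLinearMap.proj (R := L) (φ := fun _ : ι => L) i) z := by
  classical
  induction q using MvPolynomial.induction_on with
  | C a =>
    simp only [MvPolynomial.aeval_C]
    convert! hasStrictFDerivAt_const (𝕜 := L) (algebraMap K L a) z using 1
    ext h
    simp
  | add p q hp hq =>
    simp only [map_add]
    convert! hp.fun_add hq using 1
    ext h
    simp [add_mul, Finset.sum_add_distrib]
  | mul_X p j hp =>
    have hX : HasStrictFDerivAt (fun z : ι → L => z j)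
      (ContinuousLinearMap.proj (R := L) (φ := fun _ : ι => L) j) z :=
      (ContinuousLinearMap.proj (R := L) (φ := fun _ : ι => L) j).hasStrictFDerivAt
    simp only [map_mul, MvPolynomial.aeval_X]
    convert! hp.fun_mul hX using 1
    ext h
    simp [Derivation.leibniz, MvPolynomial.pderiv_X, Pi.single_apply, apply_ite]
    simp [add_mul, Finset.sum_add_distrib, Finset.mul_sum, mul_assoc]

namespace Algebra.SubmersivePresentation

variable [Finite σ] (P : Algebra.SubmersivePresentation K A ι σ)

/-- A tangent vector to the zero locus of the relations is determined by its free coordinates. -/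
lemma eq_zero_of_sum_pderiv_eq_zero [Fintype ι] (φ : A →ₐ[K] L) (h : ι → L)
    (h0 : ∀ i ∉ Set.range P.map, h i = 0)
    (hg : ∀ j, ∑ i, φ (MvPolynomial.aeval P.val (MvPolynomial.pderiv i (P.relation j))) * h i = 0) :
    h = 0 := by
  classical
  have := Fintype.ofFinite σ
  ext i
  by_cases hi : i ∈ Set.range P.map
  swap
  · exact h0 i hi
  obtain ⟨j₀, rfl⟩ := hi
  have hg' : ∀ j, ∑ l, φ (P.basisDeriv j l) * h (P.map l) = 0 := fun j => by
    rw [← hg j]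
    simp only [basisDeriv_apply]
    exact Fintype.sum_of_injective P.map P.map_inj _
      (fun i => φ (MvPolynomial.aeval P.val (MvPolynomial.pderiv i (P.relation j))) * h i)
      (fun i hi => by rw [h0 i hi, mul_zero]) (fun _ => rfl)
  -- Submersivity makes the rows of the Jacobian a basis; expanding a standard vector in it inverts
  -- the matrix, and `φ` carries the inverse to `L`.
  have hsum := P.basisDeriv.sum_repr (Pi.single j₀ (1 : A))
  have key : ∀ l, ∑ j, φ (P.basisDeriv.repr (Pi.single j₀ 1) j) * φ (P.basisDeriv j l) =
      if l = j₀ then 1 else 0 := fun l => by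
    have := congrArg φ (congrFun hsum l)
    rw [Finset.sum_apply, map_sum, Pi.single_apply] at this
    simp only [Pi.smul_apply, smul_eq_mul, map_mul] at this
    rw [this]
    split_ifs <;> simp
  calc h (P.map j₀) = ∑ l, (if l = j₀ then 1 else 0) * h (P.map l) := by simp
    _ = ∑ l, ∑ j, φ (P.basisDeriv.repr (Pi.single j₀ 1) j) * φ (P.basisDeriv j l) *
        h (P.map l) := by simp only [← key, Finset.sum_mul]
    _ = ∑ j, φ (P.basisDeriv.repr (Pi.single j₀ 1) j) *
        ∑ l, φ (P.basisDeriv j l) * h (P.map l) := by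
      rw [Finset.sum_comm]
      simp only [Finset.mul_sum, mul_assoc]
    _ = 0 := by simp only [hg', mul_zero, Finset.sum_const_zero]

/-- The points with values in a complete field near a given one are parametrized by the free
coordinates. -/
theorem exists_local_points [CompleteSpace L] [Finite ι] (φ : A →ₐ[K] L) :
    ∃ Φ : (↥(Set.range P.map)ᶜ → L) → (A →ₐ[K] L), Φ (fun t => φ (P.val t)) = φ ∧
      (∀ᶠ u in 𝓝 (fun t : ↥(Set.range P.map)ᶜ => φ (P.val t)), ∀ t : ↥(Set.range P.map)ᶜ, Φ u (P.val t) = u t) ∧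
      ∀ a, ∃ D : (↥(Set.range P.map)ᶜ → L) →L[L] L,
        HasFDerivAt (fun u => Φ u a) D (fun t => φ (P.val t)) := by
  classical
  have := Fintype.ofFinite ι
  have := Fintype.ofFinite σ
  let T := ↥(Set.range P.map)ᶜ
  let z₀ : ι → L := fun i => φ (P.val i)
  let u₀ : T → L := fun t => φ (P.val t)
  have hφ : ∀ q : MvPolynomial ι K, MvPolynomial.aeval z₀ q = φ (MvPolynomial.aeval P.val q) :=
    fun q => (MvPolynomial.comp_aeval_apply _ φ q).symm
  -- Adjoining the free coordinates to the relations gives a square system, whose derivative at `z₀`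
  -- is injective and hence invertible.
  let H : (ι → L) → (σ → L) × (T → L) := fun z =>
    (fun j => MvPolynomial.aeval z (P.relation j), fun t => z t)
  let dH : (ι → L) →L[L] (σ → L) × (T → L) :=
    (ContinuousLinearMap.pi fun j => ∑ i, MvPolynomial.aeval z₀ (MvPolynomial.pderiv i (P.relation j)) •
        ContinuousLinearMap.proj (R := L) (φ := fun _ : ι => L) i).prod
      (ContinuousLinearMap.pi fun t : T => ContinuousLinearMap.proj (R := L) (φ := fun _ : ι => L) t)
  have hinj : Function.Injective dH := by
    rw [injective_iff_map_eq_zero]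
    intro h hh
    refine P.eq_zero_of_sum_pderiv_eq_zero φ h (fun i hi => ?_) fun j => ?_
    · exact congrFun (congrArg Prod.snd hh) ⟨i, hi⟩
    · have := congrFun (congrArg Prod.fst hh) j
      simpa [dH, hφ] using this
  have hcard : Module.finrank L (ι → L) = Module.finrank L ((σ → L) × (T → L)) := by
    simp only [Module.finrank_prod, Module.finrank_fintype_fun_eq_card, T, Fintype.card_compl_set,
      Set.card_range_of_injective P.map_inj]
    have := Fintype.card_le_of_injective P.map P.map_inj
    omega
  let e : (ι → L) ≃L[L] (σ → L) × (T → L) :=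
    (LinearEquiv.ofInjectiveOfFinrankEq (dH : (ι → L) →ₗ[L] _) hinj hcard).toContinuousLinearEquiv
  have he : (e : (ι → L) →L[L] (σ → L) × (T → L)) = dH := by
    ext1 h
    rfl
  have hH : HasStrictFDerivAt H (e : (ι → L) →L[L] (σ → L) × (T → L)) z₀ := by
    rw [he]
    refine HasStrictFDerivAt.prodMk ?_ ?_
    · exact hasStrictFDerivAt_pi.mpr fun j => MvPolynomial.hasStrictFDerivAt_aeval _ _
    · exact hasStrictFDerivAt_pi.mpr fun t =>
        (ContinuousLinearMap.proj (R := L) (φ := fun _ : ι => L) (t : ι)).hasStrictFDerivAt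
  have hH0 : H z₀ = (0, u₀) := by
    refine Prod.ext (funext fun j => ?_) rfl
    change MvPolynomial.aeval z₀ (P.relation j) = 0
    rw [hφ, P.aeval_val_relation, map_zero]
  let Ψ : (T → L) → (ι → L) := fun u => hH.localInverse H e z₀ (0, u)
  have hΨ0 : Ψ u₀ = z₀ := by
    change hH.localInverse H e z₀ (0, u₀) = z₀
    rw [← hH0, hH.localInverse_apply_image]
  have hΨ : ∀ᶠ u in 𝓝 u₀, H (Ψ u) = (0, u) := by
    have h1 := hH.eventually_right_inverse
    rw [hH0] at h1
    have h2 : ContinuousAt (fun u : T → L => ((0 : σ → L), u)) u₀ := by fun_prop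
    exact h2.eventually h1
  have hΨd : ∃ D : (T → L) →L[L] (ι → L), HasFDerivAt Ψ D u₀ := by
    have h1 := hH.to_localInverse.hasFDerivAt
    rw [hH0] at h1
    exact ⟨_, h1.comp u₀ (ContinuousLinearMap.inr L (σ → L) (T → L)).hasFDerivAt⟩
  -- The relations generate the kernel of the presentation, so a common zero of them is a point of
  -- `A`.
  have hlift : ∀ u, H (Ψ u) = (0, u) →
      ∃ χ : A →ₐ[K] L, ∀ q : MvPolynomial ι K, χ (MvPolynomial.aeval P.val q) = MvPolynomial.aeval (Ψ u) q := by
    intro u hu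
    have hker : ∀ q : MvPolynomial ι K, MvPolynomial.aeval P.val q = 0 → MvPolynomial.aeval (Ψ u) q = 0 := by
      intro q hq
      have hq' : q ∈ Ideal.span (Set.range P.relation) := by
        rw [P.span_range_relation_eq_ker, P.ker_eq_ker_aeval_val]
        exact hq
      have hle : Ideal.span (Set.range P.relation) ≤
          RingHom.ker (MvPolynomial.aeval (R := K) (Ψ u)) := by
        rw [Ideal.span_le]
        rintro _ ⟨j, rfl⟩
        exact congrFun (congrArg Prod.fst hu) j
      exact hle hq'
    let χ : A →+* L := RingHom.liftOfRightInverse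
      (MvPolynomial.aeval P.val : MvPolynomial ι K →ₐ[K] A).toRingHom P.σ P.aeval_val_σ
      ⟨(MvPolynomial.aeval (Ψ u) : MvPolynomial ι K →ₐ[K] L).toRingHom, hker⟩
    have hχ : ∀ q : MvPolynomial ι K,
        χ (MvPolynomial.aeval P.val q) = MvPolynomial.aeval (Ψ u) q := fun q =>
      RingHom.liftOfRightInverse_comp_apply _ _ _ _ q
    refine ⟨{ χ with commutes' := fun c => ?_ }, hχ⟩
    have := hχ (MvPolynomial.C c)
    rwa [MvPolynomial.aeval_C, MvPolynomial.aeval_C] at this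
  -- Where `Ψ u` does not solve the system, `φ` is a default value; near `u₀` it is never used.
  let Φ : (T → L) → (A →ₐ[K] L) := fun u =>
    if hu : H (Ψ u) = (0, u) then (hlift u hu).choose else φ
  have hΦ : ∀ u, H (Ψ u) = (0, u) → ∀ q : MvPolynomial ι K, Φ u (MvPolynomial.aeval P.val q) =
      MvPolynomial.aeval (Ψ u) q := by
    intro u hu
    simp only [Φ, dif_pos hu]
    exact (hlift u hu).choose_spec
  refine ⟨Φ, ?_, ?_, fun a => ?_⟩
  · ext a
    rw [← P.aeval_val_σ a, hΦ u₀ (by rw [hΨ0, hH0]), hΨ0, hφ]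
  · filter_upwards [hΨ] with u hu t
    have := hΦ u hu (MvPolynomial.X t)
    rw [MvPolynomial.aeval_X, MvPolynomial.aeval_X] at this
    rw [this]
    exact congrFun (congrArg Prod.snd hu) t
  · obtain ⟨D, hD⟩ := hΨd
    have h1 := (MvPolynomial.hasStrictFDerivAt_aeval (P.σ a) (Ψ u₀)).hasFDerivAt.comp u₀ hD
    refine ⟨_, h1.congr_of_eventuallyEq ?_⟩
    filter_upwards [hΨ] with u hu
    conv_lhs => rw [← P.aeval_val_σ a]
    exact hΦ u hu _

end Algebra.SubmersivePresentation

end LocalPoints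

/-! ### Separating the relative part of a form from the constants -/

section Expansion

variable {K A : Type u} [Field K] [CommRing A] [Algebra K A]

/-- This is exactness of `A ⊗ Ω_K → Ω_A → Ω_{A/K}` in the middle. -/
lemma mem_span_of_relForm_eq_zero {η : Ω[A⁄ℤ]} (h : relForm K A η = 0) :
    η ∈ Submodule.span A
      (Set.range fun c : K => KaehlerDifferential.D ℤ A (algebraMap K A c)) := by
  have h1 : η ∈ LinearMap.range (KaehlerDifferential.mapBaseChange ℤ K A) := by
    rw [KaehlerDifferential.range_mapBaseChange]
    exact h
  obtain ⟨x, rfl⟩ := h1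
  clear h
  induction x with
  | zero => simp
  | add x y hx hy =>
    rw [map_add]
    exact add_mem hx hy
  | tmul a x =>
    rw [KaehlerDifferential.mapBaseChange_tmul]
    refine Submodule.smul_mem _ _ ?_
    have hx : x ∈ Submodule.span K (Set.range (KaehlerDifferential.D ℤ K)) := by
      rw [KaehlerDifferential.span_range_derivation]
      trivial
    induction hx using Submodule.span_induction with
    | mem x hx =>
      obtain ⟨c, rfl⟩ := hx
      rw [KaehlerDifferential.map_D]
      exact Submodule.subset_span ⟨c, rfl⟩
    | zero => simp
    | add x y _ _ hx hy =>
      rw [map_add]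
      exact add_mem hx hy
    | smul c x _ hx =>
      rw [map_smul, ← algebraMap_smul A c]
      exact Submodule.smul_mem _ _ hx

variable {ι σ : Type*} [Finite σ]

/-- An absolute 1-form, in terms of the free coordinates and of constants, evaluated at points. -/
lemma exists_expansion (P : Algebra.SubmersivePresentation K A ι σ) [Fintype ↥(Set.range P.map)ᶜ]
    (η : Ω[A⁄ℤ]) :
    ∃ s : K →₀ A, ∀ (L : Type u) [Field L] [Algebra K L] (θ : Ω[L⁄ℤ] →ₗ[L] L) (φ : A →ₐ[K] L),
      θ (pullForm φ.toRingHom η) =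
        (∑ t, φ (P.basisKaehler.repr (relForm K A η) t) * formDerivation θ (φ (P.val t))) +
        s.sum fun c a => φ a * formDerivation θ (algebraMap K L c) := by
  let F := P.basisKaehler.repr (relForm K A η)
  -- A lift of the relative part of `η`; the difference `η - η₁` dies in the relative forms and so
  -- comes from differentials of constants.
  let η₁ : Ω[A⁄ℤ] := ∑ t, F t • KaehlerDifferential.D ℤ A (P.val t)
  have h3 : ∀ (a : A) (x : Ω[A⁄ℤ]), relForm K A (a • x) = a • relForm K A x := fun a x =>
    map_smul (KaehlerDifferential.map ℤ K A A) a x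
  have h5 : ∀ a : A, relForm K A (KaehlerDifferential.D ℤ A a) = KaehlerDifferential.D K A a :=
    fun a => KaehlerDifferential.map_D ℤ K A A a
  have h1 : relForm K A η₁ = relForm K A η := by
    rw [map_sum]
    conv_rhs => rw [← P.basisKaehler.sum_repr (relForm K A η)]
    refine Finset.sum_congr rfl fun t _ => ?_
    rw [h3, h5, Algebra.SubmersivePresentation.basisKaehler_apply]
  have h2 := mem_span_of_relForm_eq_zero (K := K) (η := η - η₁) (by rw [map_sub, h1, sub_self])
  rw [Finsupp.mem_span_range_iff_exists_finsupp] at h2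
  obtain ⟨s, hs⟩ := h2
  refine ⟨s, fun L _ _ θ φ => ?_⟩
  have h6 : η = η₁ + s.sum fun c a => a • KaehlerDifferential.D ℤ A (algebraMap K A c) := by
    rw [hs]
    abel
  conv_lhs => rw [h6]
  simp only [η₁, Finsupp.sum, map_add, map_sum, pullForm_smul, pullForm_D, map_smul, smul_eq_mul]
  congr 1
  refine Finset.sum_congr rfl fun c _ => ?_
  have : φ.toRingHom (algebraMap K A c) = algebraMap K L c := φ.commutes c
  rw [this]
  rfl

end Expansion

/-! ### Constancy near a point forces the relative part to vanish there -/

section Constant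

open Filter

variable {K A L : Type u} [Field K] [CommRing A] [Algebra K A] [NontriviallyNormedField L]
  [Algebra K L] {ι σ : Type*} [Finite σ]

/-- The topology of pointwise convergence on the `L`-points of an algebra. -/
abbrev pointTopology (K A L : Type*) [CommRing K] [CommRing A] [Algebra K A] [CommRing L]
    [Algebra K L] [TopologicalSpace L] : TopologicalSpace (A →ₐ[K] L) :=
  TopologicalSpace.induced (fun φ s => φ s) (inferInstance : TopologicalSpace (A → L))

lemma tendsto_pointTopology {X : Type*} {l : Filter X} {Φ : X → (A →ₐ[K] L)} {φ : A →ₐ[K] L}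
    (h : ∀ a, Tendsto (fun u => Φ u a) l (𝓝 (φ a))) :
    Tendsto Φ l (@nhds _ (pointTopology K A L) φ) := by
  rw [@nhds_induced, tendsto_comap_iff]
  exact tendsto_pi_nhds.mpr h

/-- A differentiable function of one variable which takes only one value at the `p`-th powers near
zero has derivative zero there. -/
lemma hasDerivAt_eq_zero_of_pow {γ : L → L} {γ' : L} (h : HasDerivAt γ γ' 0) {p : ℕ} (hp : p ≠ 0)
    (hc : ∀ᶠ r in 𝓝 (0 : L), γ (r ^ p) = γ 0) : γ' = 0 := by
  have h1 := hasDerivAt_iff_tendsto_slope.mp h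
  have h2 : Tendsto (fun r : L => r ^ p) (𝓝[≠] 0) (𝓝[≠] 0) := by
    refine tendsto_nhdsWithin_iff.mpr ⟨?_, ?_⟩
    · have := (continuous_pow p : Continuous fun r : L => r ^ p).tendsto 0
      rw [zero_pow hp] at this
      exact this.mono_left nhdsWithin_le_nhds
    · filter_upwards [self_mem_nhdsWithin] with r hr
      exact pow_ne_zero p hr
  have h3 : Tendsto (fun _ : L => (0 : L)) (𝓝[≠] 0) (𝓝 γ') := by
    refine (h1.comp h2).congr' ?_
    filter_upwards [nhdsWithin_le_nhds hc] with r hr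
    simp [slope, hr]
  exact (tendsto_nhds_unique h3 tendsto_const_nhds)

/-- If the values of a 1-form are constant near a point, then its relative part vanishes there. -/
theorem repr_relForm_eq_zero_of_eventually_const [CompleteSpace L] [Finite ι]
    (p : ℕ) [Fact p.Prime] [CharP L p] (P : Algebra.SubmersivePresentation K A ι σ)
    (η : Ω[A⁄ℤ]) (θ : Ω[L⁄ℤ] →ₗ[L] L) (hθ : ∃ a, formDerivation θ a ≠ 0) (φ : A →ₐ[K] L)
    (hc : ∀ᶠ χ in @nhds _ (pointTopology K A L) φ,
      θ (pullForm χ.toRingHom η) = θ (pullForm φ.toRingHom η)) (t : ↥(Set.range P.map)ᶜ) :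
    φ (P.basisKaehler.repr (relForm K A η) t) = 0 := by
  classical
  have := Fintype.ofFinite ↥(Set.range P.map)ᶜ
  let T := ↥(Set.range P.map)ᶜ
  let δ := formDerivation θ
  let F := P.basisKaehler.repr (relForm K A η)
  obtain ⟨s, hs⟩ := exists_expansion P η
  obtain ⟨Φ, hΦ0, hΦ1, hΦ2⟩ := P.exists_local_points φ
  choose D hD using hΦ2
  let u₀ : T → L := fun t => φ (P.val t)
  have hΦt : Tendsto Φ (𝓝 u₀) (@nhds _ (pointTopology K A L) φ) := by
    refine tendsto_pointTopology fun a => ?_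
    have := (hD a).continuousAt.tendsto
    rwa [hΦ0] at this
  have key : ∀ h : T → L, (∑ t, (D (F t) h * δ (u₀ t) + φ (F t) * δ (h t))) +
      s.sum (fun c a => D a h * δ (algebraMap K L c)) = 0 := by
    intro h
    -- Here `δ (u₀ t + r * h t)` is replaced by `δ (u₀ t) + r * δ (h t)`, which is differentiable in
    -- `r`. The two agree when `r` is a `p`-th power, so only there is `γ` known to be a value of
    -- the form.
    let γ : L → L := fun r => (∑ t, Φ (u₀ + r • h) (F t) * (δ (u₀ t) + r * δ (h t))) +
      s.sum fun c a => Φ (u₀ + r • h) a * δ (algebraMap K L c)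
    have hline : HasDerivAt (fun r : L => u₀ + r • h) h 0 := by
      simpa using ((hasDerivAt_id (0 : L)).smul_const h).const_add u₀
    have hz : u₀ + (0 : L) • h = u₀ := by simp
    have hΦd : ∀ a, HasDerivAt (fun r : L => Φ (u₀ + r • h) a) (D a h) 0 := fun a => by
      have h1 : HasFDerivAt (fun u => Φ u a) (D a) (u₀ + (0 : L) • h) := by
        rw [hz]
        exact hD a
      exact h1.comp_hasDerivAt (0 : L) hline
    have hγ : HasDerivAt γ ((∑ t, (D (F t) h * δ (u₀ t) + φ (F t) * δ (h t))) +
        s.sum (fun c a => D a h * δ (algebraMap K L c))) 0 := by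
      refine HasDerivAt.add (HasDerivAt.fun_sum fun t _ => ?_)
        (HasDerivAt.fun_sum fun c _ => (hΦd _).mul_const _)
      have h2 : HasDerivAt (fun r : L => δ (u₀ t) + r * δ (h t)) (δ (h t)) 0 := by
        simpa using ((hasDerivAt_id (0 : L)).mul_const (δ (h t))).const_add (δ (u₀ t))
      have h3 := (hΦd (F t)).fun_mul h2
      rw [hz, show Φ u₀ = φ from hΦ0, zero_mul, add_zero] at h3
      exact h3
    refine hasDerivAt_eq_zero_of_pow hγ (Fact.out : p.Prime).ne_zero ?_
    have hlim : Tendsto (fun r : L => u₀ + r ^ p • h) (𝓝 0) (𝓝 u₀) := by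
      have : Continuous fun r : L => u₀ + r ^ p • h := by fun_prop
      have := this.tendsto 0
      rwa [zero_pow (Fact.out : p.Prime).ne_zero, hz] at this
    have hval : ∀ r : L, (∀ t : T, Φ (u₀ + r ^ p • h) (P.val t) = (u₀ + r ^ p • h) t) →
        γ (r ^ p) = θ (pullForm (Φ (u₀ + r ^ p • h)).toRingHom η) := by
      intro r hr
      rw [hs]
      simp only [hr]
      refine congrArg₂ (· + ·) (Finset.sum_congr rfl fun t _ => ?_) rfl
      rw [Pi.add_apply, Pi.smul_apply, smul_eq_mul, map_add, derivation_pow_mul p]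
    have h0 : γ 0 = θ (pullForm φ.toRingHom η) := by
      have h1 := hval 0 (by
        rw [zero_pow (Fact.out : p.Prime).ne_zero, hz]
        exact hΦ1.self_of_nhds)
      rw [zero_pow (Fact.out : p.Prime).ne_zero, hz, show Φ u₀ = φ from hΦ0] at h1
      exact h1
    filter_upwards [hlim.eventually hΦ1, (hΦt.comp hlim).eventually hc] with r h1 h2
    rw [hval r h1, h0]
    exact h2
  obtain ⟨a, ha⟩ := hθ
  -- Along `e_t` the term in `δ (h t)` is `δ 1 = 0`. Subtracting `a` times this identity from the
  -- one for `a • e_t` cancels everything `L`-linear and leaves `φ (F t) * δ a = 0`.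
  have k1 := key (Pi.single t 1)
  have k2 := key (a • Pi.single t 1)
  simp only [map_smul, smul_eq_mul, Pi.smul_apply, Pi.single_apply, mul_ite, mul_one, mul_zero,
    apply_ite δ, map_zero, Derivation.map_one_eq_zero, Finset.sum_add_distrib, Finset.sum_ite_eq',
    Finset.mem_univ, if_true, ite_self, add_zero] at k1 k2
  have k3 : a * ((∑ t', D (F t') (Pi.single t 1) * δ (u₀ t')) +
      s.sum (fun c b => D b (Pi.single t 1) * δ (algebraMap K L c))) + φ (F t) * δ a = 0 := by
    rw [← k2, Finsupp.sum, Finsupp.sum, mul_add, Finset.mul_sum, Finset.mul_sum]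
    simp only [mul_assoc]
    ring
  rw [k1, mul_zero, zero_add] at k3
  exact (mul_eq_zero.mp k3).resolve_right ha

end Constant

/-! ### Local points are dense in a smooth integral affine scheme -/

section Density

open Filter

/-- A polynomial which vanishes on a neighbourhood of a point is zero. -/
lemma MvPolynomial.eq_zero_of_eventually_aeval_eq_zero {K L T : Type*} [Field K]
    [NontriviallyNormedField L] [Algebra K L] [Finite T] (q : MvPolynomial T K) (u₀ : T → L)
    (h : ∀ᶠ u in 𝓝 u₀, MvPolynomial.aeval u q = 0) : q = 0 := by
  rw [nhds_pi, Filter.eventually_iff, Filter.mem_pi] at h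
  obtain ⟨I, -, s, hs, hsub⟩ := h
  apply MvPolynomial.map_injective _ (algebraMap K L).injective
  rw [map_zero]
  refine MvPolynomial.funext_set s (fun t => infinite_of_mem_nhds _ (hs t)) fun u hu => ?_
  rw [MvPolynomial.eval_map, map_zero]
  exact hsub fun t _ => hu t trivial

variable {K A : Type u} [Field K] [CommRing A] [Algebra K A] {ι σ : Type*} [Finite σ]

/-- A standard smooth domain is algebraic over the polynomial ring in the free coordinates if these
are algebraically independent. -/
lemma isAlgebraic_of_submersivePresentation [IsDomain A] [Finite ι]
    (P : Algebra.SubmersivePresentation K A ι σ)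
    (hinj : Function.Injective (MvPolynomial.aeval (R := K)
      fun t : ↥(Set.range P.map)ᶜ => P.val t)) (a : A) (ha : a ≠ 0) :
    ∃ q : MvPolynomial ↥(Set.range P.map)ᶜ K, q ≠ 0 ∧
      a ∣ MvPolynomial.aeval (fun t : ↥(Set.range P.map)ᶜ => P.val t) q := by
  let T := ↥(Set.range P.map)ᶜ
  let R := MvPolynomial T K
  let _ : Algebra R A := (MvPolynomial.aeval (R := K) fun t : T => P.val t).toRingHom.toAlgebra
  have hRA : algebraMap R A = (MvPolynomial.aeval (R := K) fun t : T => P.val t).toRingHom := rfl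
  have : IsScalarTower K R A := IsScalarTower.of_algebraMap_eq fun c =>
    ((MvPolynomial.aeval (R := K) fun t : T => P.val t).commutes c).symm
  have : FaithfulSMul R A := (faithfulSMul_iff_algebraMap_injective R A).mpr hinj
  have hfin : Algebra.FiniteType K A := by
    have := P.finitePresentation_of_isFinite
    infer_instance
  -- The differentials of the free coordinates form a basis over `K` and vanish over `R`.
  have hunr : Algebra.FormallyUnramified R A := by
    have hsurj := KaehlerDifferential.map_surjective K R A
    have hzero : KaehlerDifferential.map K R A A = 0 := by
      refine P.basisKaehler.ext fun t => ?_
      rw [Algebra.SubmersivePresentation.basisKaehler_apply, KaehlerDifferential.map_D]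
      have : algebraMap A A (P.val t) = algebraMap R A (MvPolynomial.X t) := by
        rw [hRA]
        exact (MvPolynomial.aeval_X (R := K) (fun t : T => P.val t) t).symm
      rw [this, Derivation.map_algebraMap]
      rfl
    refine ⟨⟨fun x y => ?_⟩⟩
    obtain ⟨x, rfl⟩ := hsurj x
    obtain ⟨y, rfl⟩ := hsurj y
    rw [hzero]
    rfl
  let M := FractionRing A
  let M₀ := FractionRing R
  let _ : Algebra M₀ M := FractionRing.liftAlgebra R M
  have : IsScalarTower R M₀ M := FractionRing.isScalarTower_liftAlgebra R M
  have : Algebra.FormallyUnramified A M :=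
    Algebra.FormallyUnramified.of_isLocalization (nonZeroDivisors A)
  have : Algebra.FormallyUnramified R M := Algebra.FormallyUnramified.comp R A M
  have : Algebra.FormallyUnramified M₀ M := Algebra.FormallyUnramified.of_restrictScalars R M₀ M
  have : Algebra.EssFiniteType A M := Algebra.EssFiniteType.of_isLocalization _ (nonZeroDivisors A)
  have : Algebra.EssFiniteType R A := Algebra.EssFiniteType.of_comp K R A
  have : Algebra.EssFiniteType R M := Algebra.EssFiniteType.comp R A M
  have : Algebra.EssFiniteType M₀ M := Algebra.EssFiniteType.of_comp R M₀ M
  -- An unramified field extension that is essentially of finite type is separable algebraic;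
  -- algebraicity then descends from the fraction fields to `A` over `R`.
  have : Algebra.IsSeparable M₀ M := Algebra.FormallyUnramified.isSeparable M₀ M
  have : Algebra.IsAlgebraic M₀ M := inferInstance
  have : Algebra.IsAlgebraic R M := (IsFractionRing.comap_isAlgebraic_iff (K := M₀)).mpr this
  have halg : IsAlgebraic R a :=
    (isAlgebraic_algebraMap_iff (IsFractionRing.injective A M)).mp
      (Algebra.IsAlgebraic.isAlgebraic (algebraMap A M a))
  obtain ⟨q, hq, hd⟩ := halg.exists_nonzero_dvd (mem_nonZeroDivisors_of_ne_zero ha)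
  exact ⟨q, hq, hd⟩

variable {L : Type u} [NontriviallyNormedField L] [CompleteSpace L] [Algebra K L]

/-- A regular function on a smooth integral affine scheme which vanishes at all points near a given
one is zero. -/
theorem eq_zero_of_eventually_apply_eq_zero [IsDomain A] [Finite ι]
    (P : Algebra.SubmersivePresentation K A ι σ) (φ : A →ₐ[K] L) (a : A)
    (h : ∀ᶠ χ in @nhds _ (pointTopology K A L) φ, χ a = 0) : a = 0 := by
  by_contra ha
  let T := ↥(Set.range P.map)ᶜ
  obtain ⟨Φ, hΦ0, hΦ1, hΦ2⟩ := P.exists_local_points φ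
  have hΦt : Tendsto Φ (𝓝 fun t => φ (P.val t)) (@nhds _ (pointTopology K A L) φ) := by
    refine tendsto_pointTopology fun a => ?_
    obtain ⟨D, hD⟩ := hΦ2 a
    have := hD.continuousAt.tendsto
    rwa [hΦ0] at this
  -- A polynomial in the free coordinates divisible by `a` vanishes for all parameters near the
  -- centre. This is used twice: for `q` mapping to zero, to show independence of the coordinates,
  -- and then for a nonzero `q` divisible by `a`.
  have key : ∀ q : MvPolynomial T K, a ∣ MvPolynomial.aeval (fun t : T => P.val t) q → q = 0 := by
    rintro q ⟨b, hb⟩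
    refine MvPolynomial.eq_zero_of_eventually_aeval_eq_zero q (fun t : T => φ (P.val t)) ?_
    filter_upwards [hΦ1, hΦt.eventually h] with u h1 h2
    have h3 : Φ u (MvPolynomial.aeval (fun t : T => P.val t) q) = 0 := by
      rw [hb, map_mul, h2, zero_mul]
    rw [MvPolynomial.comp_aeval_apply] at h3
    rw [← h3]
    congr 2
    exact funext fun t => (h1 t).symm
  have hinj : Function.Injective (MvPolynomial.aeval (R := K) fun t : T => P.val t) := by
    rw [injective_iff_map_eq_zero]
    intro q hq
    exact key q (hq ▸ dvd_zero a)
  obtain ⟨q, hq, hd⟩ := isAlgebraic_of_submersivePresentation P hinj a ha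
  exact hq (key q hd)

/-- A 1-form on a smooth integral affine scheme whose relative part is nonzero is not constant near
any point. -/
theorem not_eventually_const [IsDomain A] [Finite ι] (p : ℕ) [Fact p.Prime] [CharP L p]
    (P : Algebra.SubmersivePresentation K A ι σ) (η : Ω[A⁄ℤ]) (hη : relForm K A η ≠ 0)
    (θ : Ω[L⁄ℤ] →ₗ[L] L) (hθ : ∃ a, formDerivation θ a ≠ 0) (φ : A →ₐ[K] L) :
    ¬ ∀ᶠ χ in @nhds _ (pointTopology K A L) φ,
      θ (pullForm χ.toRingHom η) = θ (pullForm φ.toRingHom η) := by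
  intro hc
  let _ := pointTopology K A L
  apply hη
  apply P.basisKaehler.repr.injective
  ext t
  rw [map_zero, Finsupp.zero_apply]
  refine eq_zero_of_eventually_apply_eq_zero (L := L) P φ _ ?_
  -- Constancy near `φ` is constancy near every nearby point, so the coefficient vanishes on a whole
  -- neighbourhood.
  filter_upwards [hc.eventually_nhds] with χ hχ
  refine repr_relForm_eq_zero_of_eventually_const p P η θ hθ χ ?_ t
  filter_upwards [hχ] with χ' h
  rw [h, hχ.self_of_nhds]

end Density

/-! ### From affine opens to the scheme -/

section Global

variable {K : Type u} [Field K] {X : Scheme.{u}} (f : X ⟶ Spec (.of K))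

lemma smooth_sec [Smooth f] (U : X.affineOpens) : Algebra.Smooth K (Sec f U.1) := by
  have h := f.smooth_appLE (isAffineOpen_top _) U.2 (le_top : U.1 ≤ f ⁻¹ᵁ ⊤)
  have h2 : (secMap f U.1).hom.Smooth := by
    rw [secMap, CommRingCat.hom_comp]
    exact RingHom.Smooth.respectsIso.2 _
      ((Scheme.ΓSpecIso (.of K)).symm.commRingCatIsoToRingEquiv) h
  exact h2

lemma exists_isStandardSmooth_sec [Smooth f] (z : X) :
    ∃ U : X.affineOpens, z ∈ U.1 ∧ Algebra.IsStandardSmooth K (Sec f U.1) := by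
  obtain ⟨V, hV, U, hU, hz, e, h⟩ := Smooth.exists_isStandardSmooth f z
  -- The spectrum of a field has one point.
  have hVtop : V = ⊤ := by
    have hzV : f z ∈ V := e hz
    ext y
    have : Subsingleton (Spec (.of K)) := inferInstanceAs (Subsingleton (PrimeSpectrum K))
    rw [Subsingleton.elim y (f z)]
    exact iff_of_true hzV trivial
  subst hVtop
  refine ⟨⟨U, hU⟩, hz, ?_⟩
  have h2 : (secMap f U).hom.IsStandardSmooth := by
    rw [secMap, CommRingCat.hom_comp]
    exact RingHom.isStandardSmooth_respectsIso.2 _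
      ((Scheme.ΓSpecIso (.of K)).symm.commRingCatIsoToRingEquiv) h
  exact h2

/-- The restriction of relative 1-forms to a nonempty basic open subset of an integral smooth affine
scheme is injective. -/
lemma eq_zero_of_pullRelForm_basicOpen [Smooth f] [IsIntegral X] (U : X.affineOpens)
    (g : Γ(X, U.1)) (hne : (X.basicOpen g : Set X).Nonempty) (η : Ω[Sec f U.1⁄K])
    (h : pullRelForm (Sec.res f (X.basicOpen_le g)) η = 0) : η = 0 := by
  have := smooth_sec f U
  have : Nonempty U.1 := by
    obtain ⟨z, hz⟩ := hne
    exact ⟨⟨z, X.basicOpen_le g hz⟩⟩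
  have : IsDomain (Sec f U.1) := inferInstanceAs (IsDomain Γ(X, U.1))
  have hg : g ≠ 0 := by
    rintro rfl
    rw [Scheme.basicOpen_zero] at hne
    exact hne.ne_empty rfl
  let φ := Sec.res f (X.basicOpen_le g)
  let _ := φ.toRingHom.toAlgebra
  have : IsScalarTower K (Sec f U.1) (Sec f (X.basicOpen g)) :=
    IsScalarTower.of_algebraMap_eq fun c => (φ.commutes c).symm
  let g' : Sec f U.1 := g
  have : IsLocalization.Away g' (Sec f (X.basicOpen g)) :=
    U.2.isLocalization_basicOpen g
  have h2 : KaehlerDifferential.map K K (Sec f U.1) (Sec f (X.basicOpen g)) η = 0 := h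
  rw [IsLocalizedModule.eq_zero_iff (Submonoid.powers g')
    (KaehlerDifferential.map K K (Sec f U.1) (Sec f (X.basicOpen g)))] at h2
  obtain ⟨⟨_, n, rfl⟩, hc⟩ := h2
  have hc' : g' ^ n • η = 0 := hc
  -- By smoothness the relative differentials are projective, hence torsion-free over the domain.
  exact (smul_eq_zero.mp hc').resolve_left (pow_ne_zero n hg)

/-- On an integral smooth scheme, a 1-form whose relative part vanishes on one nonempty affine open
subset has relative part zero. -/
lemma toRel_eq_zero_of_relForm_eq_zero [Smooth f] [IsIntegral X] (ω : GlobalForms f)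
    (U : X.affineOpens) (hU : (U.1 : Set X).Nonempty) (h : relForm K (Sec f U.1) (ω.1 U) = 0) :
    GlobalForms.toRel f ω = 0 := by
  apply Subtype.ext
  funext V
  have hcompat := (GlobalForms.toRel f ω).2
  change (GlobalForms.toRel f ω).1 V = 0
  by_cases hV : (V.1 : Set X).Nonempty
  · obtain ⟨z, hzV, hzU⟩ := nonempty_preirreducible_inter V.1.2 U.1.2 hV hU
    obtain ⟨g, hg, hz⟩ := V.2.exists_basicOpen_le (⟨z, hzU⟩ : U.1) hzV
    refine eq_zero_of_pullRelForm_basicOpen f V g ⟨z, hz⟩ _ ?_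
    let W : X.affineOpens := ⟨X.basicOpen g, V.2.basicOpen g⟩
    have h1 := hcompat V W (X.basicOpen_le g)
    have h2 := hcompat U W hg
    have h3 : (GlobalForms.toRel f ω).1 U = 0 := h
    rw [h3, map_zero] at h2
    exact h1.trans h2.symm
  · have : Subsingleton (Sec f V.1) := by
      have : V.1 = ⊥ := by
        ext z
        exact iff_of_false (fun hz => hV ⟨z, hz⟩) (fun hz => hz)
      rw [this]
      exact inferInstanceAs (Subsingleton Γ(X, ⊥))
    have := Module.subsingleton (Sec f V.1) (Ω[Sec f V.1⁄K])
    exact Subsingleton.elim _ _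

variable {f}

lemma Point.exists_ofHom_eq {L : Type u} [Field L] [Algebra K L] (x : Point f L) (U : X.affineOpens)
    (hU : x.1 (IsLocalRing.closedPoint L) ∈ U.1) :
    ∃ φ : Sec f U.1 →ₐ[K] L, Point.ofHom U.2 φ = x := by
  obtain ⟨V, hV, φ, hle, h⟩ := x.exists_ofHom_le U.1 fun z => by
    rwa [Subsingleton.elim (α := PrimeSpectrum L) z (IsLocalRing.closedPoint L)]
  exact ⟨φ.comp (Sec.res f hle), (Point.ofHom_res U.2 hV hle φ).trans h⟩

lemma Point.eventually_ofHom {L : Type u} [Field L] [Algebra K L] [TopologicalSpace L]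
    (U : X.affineOpens) (φ : Sec f U.1 →ₐ[K] L) {W : Set (Point f L)}
    (hW : W ∈ 𝓝 (Point.ofHom U.2 φ)) :
    ∀ᶠ χ in @nhds _ (affineTopology f L U.1) φ, Point.ofHom U.2 χ ∈ W := by
  let _ := affineTopology f L U.1
  have hc : Continuous (Point.ofHom U.2 : (Sec f U.1 →ₐ[K] L) → Point f L) := by
    rw [continuous_iff_coinduced_le]
    exact le_iSup (fun U : X.affineOpens =>
      TopologicalSpace.coinduced (Point.ofHom U.2) (affineTopology f L U)) U
  exact hc.continuousAt hW

end Global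

/-- Exact differentials span, so a linear form killing all of them is zero and no isomorphism. -/
lemma exists_formDerivation_ne_zero {L : Type u} [Field L] (θ : Ω[L⁄ℤ] ≃ₗ[L] L) :
    ∃ a, formDerivation (θ : Ω[L⁄ℤ] →ₗ[L] L) a ≠ 0 := by
  by_contra! h
  have h0 : (θ : Ω[L⁄ℤ] →ₗ[L] L) = 0 := by
    refine LinearMap.ext_on_range (v := KaehlerDifferential.D ℤ L)
      (KaehlerDifferential.span_range_derivation ℤ L) fun a => ?_
    exact h a
  have := congrArg (fun t : Ω[L⁄ℤ] →ₗ[L] L => t (θ.symm 1)) h0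
  simp at this

end

/-! ### The main theorem -/

theorem mainTheorem11 (p : ℕ) [Fact p.Prime] (K : Type u) [Field K] [CharP K p]
    [Algebra (RatFunc (ZMod p)) K] [FunctionField (ZMod p) K] (v : Place K)
    (X : Scheme.{u}) (f : X ⟶ Spec (.of K)) [Smooth f] (ω : GlobalForms f) :
    (Nonempty (Ω[v.Completion⁄ℤ] ≃ₗ[v.Completion] v.Completion) ∧
      ∀ θ : Ω[v.Completion⁄ℤ] ≃ₗ[v.Completion] v.Completion,
        IsPAnalytic p fun x : Point f v.Completion => θ (GlobalForms.eval ω x)) ∧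
    (IsIntegral X → GlobalForms.toRel f ω ≠ 0 →
      ∀ x : Point f v.Completion, ∀ W ∈ 𝓝 x, ∃ y ∈ W,
        GlobalForms.eval ω y ≠ GlobalForms.eval ω x) := by
  obtain ⟨hfin, hne, s, hs⟩ := v.exists_adjoin_powSubfield_eq_top p
  have hequiv := nonempty_kaehlerDifferential_equiv p s hs hne
  refine ⟨⟨hequiv, fun θ => ⟨continuous_eval p ω (θ : Ω[v.Completion⁄ℤ] →ₗ[v.Completion] _),
    analyticAfterWeilRestriction_eval p (fun U => ?_) ω
      (θ : Ω[v.Completion⁄ℤ] →ₗ[v.Completion] _)⟩⟩, fun hX hω x W hW => ?_⟩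
  · have := smooth_sec f U
    infer_instance
  obtain ⟨θ⟩ := hequiv
  by_contra! hcon
  obtain ⟨U, hzU, hU⟩ := exists_isStandardSmooth_sec f (x.1 (IsLocalRing.closedPoint v.Completion))
  obtain ⟨φ, rfl⟩ := x.exists_ofHom_eq U hzU
  obtain ⟨ι, σ, _, _, ⟨P⟩⟩ := hU.out
  have : Nonempty U.1 := ⟨⟨_, hzU⟩⟩
  have : IsDomain (Sec f U.1) := inferInstanceAs (IsDomain Γ(X, U.1))
  refine not_eventually_const p P (ω.1 U)
    (fun h => hω (toRel_eq_zero_of_relForm_eq_zero f ω U ⟨_, hzU⟩ h))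
    (θ : Ω[v.Completion⁄ℤ] →ₗ[v.Completion] _) (exists_formDerivation_ne_zero θ) φ ?_
  filter_upwards [Point.eventually_ofHom U φ hW] with χ hχ
  rw [← GlobalForms.eval_ofHom, ← GlobalForms.eval_ofHom, hcon _ hχ]
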